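/- Let $0<\alpha<1$ and consider the radial (two-dimensional) Robertson--Walker spacetime $\{(t,\chi): t>0\}$ with metric $ds^2=-dt^2+a(t)^2d\chi^2$, $a(t)=t^\alpha$. The central observer is $\beta(\tau)=(\tau,0)$, with 4-velocity $u=\partial/\partial t$, and the comoving test particle has the worldline $\beta'(\tau')=(\tau',\chi)$ with constant $\chi>0$. For $\tau>0$ let $p=(\tau,0)$, let the Fermi space slice $\mathcal M_\tau$ consist of the end points of the geodesics that start at $p$ orthogonally to $u$, let $q_{\mathrm s}=(t_{\mathrm s},\chi)$ be the event of $\beta'$ on $\mathcal M_\tau$, and let $\rho=\rho(\tau,\chi)$ be the Fermi distance from $p$ to $q_{\mathrm s}$, i.e. the proper length of such a geodesic from $p$ to $q_{\mathrm s}$. The kinematic relative velocity $v_{\mathrm{kin}}$ is the vector at $p$ orthogonal to $u$ such that the parallel transport to $p$, along this geodesic, of the 4-velocity of $\beta'$ at $q_{\mathrm s}$ is a multiple of $u+v_{\mathrm{kin}}$; the Fermi relative velocity is $v_{\mathrm{Fermi}}=\frac{\partial\rho}{\partial\tau}\,\mathcal S_p$, where $\mathcal S_p=\frac1{a(\tau)}\frac{\partial}{\partial\chi}$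 is the unit radial vector at $p$; $\|\cdot\|$ is the norm given by the metric. Put $$v=\frac{\alpha\chi}{\tau^{1-\alpha}},\qquad C_\alpha=\frac{\sqrt\pi\,\Gamma\left(\frac{1+\alpha}{2\alpha}\right)}{\Gamma\left(\frac1{2\alpha}\right)},\qquad F_\alpha(z)=z^{\frac{1-\alpha}{\alpha}}\,{}_2F_1\left(\tfrac12,\tfrac{1-\alpha}{2\alpha};\tfrac{1+\alpha}{2\alpha};z^2\right)\quad(0<z<1).$$ Then $F_\alpha$ is a bijection from $(0,1)$ onto $(0,C_\alpha)$. The particle meets $\mathcal M_\tau$ if and only if $v<v_{\mathrm{smax}}:=\frac{\alpha}{1-\alpha}C_\alpha$. In that case, $t_{\mathrm s}$, $\rho$, $v_{\mathrm{kin}}$ and $v_{\mathrm{Fermi}}$ exist and are unique, and with $G_\alpha(v)=\left(F_\alpha^{-1}\left(C_\alpha-\frac{1-\alpha}{\alpha}v\right)\right)^{1/\alpha}$, $$\|v_{\mathrm{kin}}\|=\sqrt{1-\frac{t_{\mathrm s}^{2\alpha}}{\tau^{2\alpha}}}=\sqrt{1-G_\alpha^{2\alpha}(v)},$$ $$\|v_{\mathrm{Fermi}}\|=G_\alpha^{1-\alpha}(v)\sqrt{1-G_\alpha^{2\alpha}(v)}+\frac{1-\alpha}{\alpha}\left(1-G_\alpha^{2\alpha}(v)\right)v=\frac{\rho}{\tau}-\frac{1-\alpha}{\alpha}G_\alpha^{2\alpha}(v)\,v.$$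 -/

import Mathlib

open Set Filter Topology

noncomputable section

namespace RobertsonWalker

/-! Two-dimensional (radial) Robertson-Walker spacetime: events are `x` with `x 0 = t > 0`
and `x 1 = χ`, and tangent vectors are given by their components in `∂/∂t, ∂/∂χ`. -/

/-- The matrix `g_{ij}` of the metric `ds² = -dt² + a(t)² dχ²` at the event `x`. -/
def metric (a : ℝ → ℝ) (x : Fin 2 → ℝ) : Matrix (Fin 2) (Fin 2) ℝ :=
  !![-1, 0; 0, a (x 0) ^ 2]

/-- The value `g_x(v, w)` of the metric. -/
def metricForm (a : ℝ → ℝ) (x v w : Fin 2 → ℝ) : ℝ :=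
  ∑ i, ∑ j, metric a x i j * v i * w j

/-- The modulus `‖v‖ = √g_x(v, v)` of a spacelike vector `v` at `x`. -/
def modulus (a : ℝ → ℝ) (x v : Fin 2 → ℝ) : ℝ :=
  Real.sqrt (metricForm a x v v)

/-- The partial derivative of `f` in the `j`-th coordinate. -/
def partialDeriv (j : Fin 2) (f : (Fin 2 → ℝ) → ℝ) (x : Fin 2 → ℝ) : ℝ :=
  deriv (fun s => f (Function.update x j s)) (x j)

/-- The Christoffel symbol `Γ^i_{jk}` of the Levi-Civita connection. -/
def christoffel (a : ℝ → ℝ) (x : Fin 2 → ℝ) (i j k : Fin 2) : ℝ :=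
  (1 / 2) * ∑ l, (metric a x)⁻¹ i l *
    (partialDeriv j (fun y => metric a y l k) x
      + partialDeriv k (fun y => metric a y l j) x
      - partialDeriv l (fun y => metric a y j k) x)

/-- The vector field `V` is parallel along the curve `γ : [0, 1] → M` with velocity `γ'`. -/
def IsParallelAlong (a : ℝ → ℝ) (γ γ' V : ℝ → Fin 2 → ℝ) : Prop :=
  ∀ s ∈ Icc (0 : ℝ) 1,
    HasDerivWithinAt V (fun i => -∑ j, ∑ k, christoffel a (γ s) i j k * γ' s j * V s k)
      (Icc 0 1) s

/-- `γ : [0, 1] → M` is a geodesic with velocity `γ'`, staying in `t > 0`. -/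
structure IsGeodesic (a : ℝ → ℝ) (γ γ' : ℝ → Fin 2 → ℝ) : Prop where
  pos : ∀ s ∈ Icc (0 : ℝ) 1, 0 < γ s 0
  hasDeriv : ∀ s ∈ Icc (0 : ℝ) 1, HasDerivWithinAt γ (γ' s) (Icc 0 1) s
  parallel : IsParallelAlong a γ γ' γ'

/-- The event `p = (τ, 0)` of the central observer `β`. -/
def observer (τ : ℝ) : Fin 2 → ℝ := ![τ, 0]

/-- The 4-velocity `u = ∂/∂t` of the central observer. -/
def observerVelocity : Fin 2 → ℝ := ![1, 0]

/-- The unit vector `𝒮_p = (1 / a(τ)) ∂/∂χ` at `p = (τ, 0)`. -/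
def unitRadial (a : ℝ → ℝ) (τ : ℝ) : Fin 2 → ℝ := ![0, 1 / a τ]

/-- `γ` is a geodesic from `p = (τ, 0)` to `q` which is orthogonal to `u` at `p`. Thus
`q = exp_p (γ' 0)` with `g(γ' 0, u) = 0`. -/
structure IsFermiGeodesic (a : ℝ → ℝ) (τ : ℝ) (q : Fin 2 → ℝ) (γ γ' : ℝ → Fin 2 → ℝ) :
    Prop where
  geodesic : IsGeodesic a γ γ'
  source : γ 0 = observer τ
  target : γ 1 = q
  orthogonal : metricForm a (observer τ) (γ' 0) observerVelocity = 0

/-- `q` is spacelike (Fermi) simultaneous with `p = (τ, 0)`, i.e. it lies on the Fermi space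
slice `ℳ_τ`. -/
def FermiSimultaneous (a : ℝ → ℝ) (τ : ℝ) (q : Fin 2 → ℝ) : Prop :=
  ∃ γ γ', IsFermiGeodesic a τ q γ γ'

/-- `d` is the Fermi distance from `p = (τ, 0)` to the particle with worldline `b`: the proper
length of an orthogonal geodesic from `p` to an event of `b` on the slice `ℳ_τ`. -/
def IsFermiDistance (a : ℝ → ℝ) (τ : ℝ) (b : ℝ → Fin 2 → ℝ) (d : ℝ) : Prop :=
  ∃ (s : ℝ) (γ γ' : ℝ → Fin 2 → ℝ), IsFermiGeodesic a τ (b s) γ γ' ∧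
    d = ∫ r in (0 : ℝ)..1, modulus a (γ r) (γ' r)

/-- `w` is the kinematic velocity, relative to the central observer at `p = (τ, 0)`, of the
particle with worldline `b` (parametrized by proper time): parallel transport to `p`, along an
orthogonal geodesic, of its 4-velocity at the event `q_s` of `b` on `ℳ_τ` is a multiple of
`u + w`, with `w` orthogonal to `u`. -/
def IsKinematicVelocity (a : ℝ → ℝ) (τ : ℝ) (b : ℝ → Fin 2 → ℝ) (w : Fin 2 → ℝ) : Prop :=
  ∃ (s : ℝ) (γ γ' V : ℝ → Fin 2 → ℝ), IsFermiGeodesic a τ (b s) γ γ' ∧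
    IsParallelAlong a γ γ' V ∧ V 1 = deriv b s ∧
    metricForm a (observer τ) w observerVelocity = 0 ∧
    ∃ c : ℝ, V 0 = c • (observerVelocity + w)

/-- `w` is the Fermi velocity, relative to the central observer at `p = (τ, 0)`, of the radially
moving particle with worldline `b` (in `χ > 0`): `w = (dρ/dτ) 𝒮_p`, where `ρ(τ')` is the Fermi
distance of the particle at the time `τ'` of the observer. -/
def IsFermiVelocity (a : ℝ → ℝ) (τ : ℝ) (b : ℝ → Fin 2 → ℝ) (w : Fin 2 → ℝ) : Prop :=
  ∃ (ρ : ℝ → ℝ) (ρ' : ℝ), (∀ᶠ τ' in 𝓝 τ, IsFermiDistance a τ' b (ρ τ')) ∧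
    HasDerivAt ρ ρ' τ ∧ w = ρ' • unitRadial a τ

/-- The worldline of a comoving particle, parametrized by its proper time. -/
def comoving (χ : ℝ) : ℝ → Fin 2 → ℝ := fun s => ![s, χ]

/-- The power scale factor `a(t) = t^α`. -/
def powerScale (α : ℝ) : ℝ → ℝ := fun t => t ^ α

/-- `C_α = √π Γ((1+α)/(2α)) / Γ(1/(2α))`. -/
def constC (α : ℝ) : ℝ :=
  Real.sqrt Real.pi * Real.Gamma ((1 + α) / (2 * α)) / Real.Gamma (1 / (2 * α))

/-- `F_α(z) = z^((1-α)/α) ₂F₁(1/2, (1-α)/(2α); (1+α)/(2α); z²)`, for `0 < z < 1`. -/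
def funF (α z : ℝ) : ℝ :=
  z ^ ((1 - α) / α) *
    ordinaryHypergeometric (1 / 2 : ℝ) ((1 - α) / (2 * α)) ((1 + α) / (2 * α)) (z ^ 2)

/-- `G_α(v) = (F_α⁻¹(C_α - ((1-α)/α) v))^(1/α)`, with the inverse of `F_α` on `(0, 1)`. -/
def funG (α v : ℝ) : ℝ :=
  (Function.invFunOn (funF α) (Ioo 0 1) (constC α - (1 - α) / α * v)) ^ (1 / α)

end RobertsonWalker

end

/-! The metric has the Killing field `∂/∂χ` and, because `a` is a power, the homothetic field `t
∂/∂t + (1 - α) χ ∂/∂χ`. Along an orthogonal geodesic these and the constancy of `g(γ', γ')` give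
three first integrals (`momentum`, `energy`, `virial`), so the geodesic equation never has to be
solved in order to prove uniqueness.

Momentum and energy make `dt/dχ` separable in `t`. With `(t/τ)^α = cos θ` the solution reads
`angleInt α θ = v`. The substitution `x = cos² θ` turns `angleInt` into an incomplete Beta integral,
and termwise integration of the binomial series identifies the latter with `F_α`
(`rpow_mul_ordinaryHypergeometric`, `funF_cos`). Hence `G_α(v) = cos θ ^ (1/α)`, and the threshold
for `v` says exactly that `t` stays positive.

The third integral gives the length `ρ` as `fermiDist` without a further quadrature. In dimension
two the pairing with `γ'` and the area spanned with `γ'` determine a parallel field, which yields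
`‖v_kin‖ = sin θ`. The Fermi velocity follows by differentiating `fermiDist`, with `θ` a local
inverse function of `v(τ)`. Existence is shown by an explicit geodesic parametrized through the
angle (`exists_isFermiGeodesic`). -/

namespace RobertsonWalker

/-! ### The incomplete Beta integral -/

/-- The function `b ∫₀ʷ x^(b-1) (1-x)^(-1/2) dx`, an incomplete Beta integral. -/
noncomputable def incBeta (b w : ℝ) : ℝ :=
  b * ∫ x in (0 : ℝ)..w, x ^ (b - 1) * (1 - x) ^ (-(1 / 2) : ℝ)

theorem betaKernel_ofReal {b x : ℝ} (hx : x ∈ uIoc (0 : ℝ) 1) :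
    (x : ℂ) ^ ((b : ℂ) - 1) * (1 - (x : ℂ)) ^ (((1 / 2 : ℝ) : ℂ) - 1)
      = ((x ^ (b - 1) * (1 - x) ^ (-(1 / 2) : ℝ) : ℝ) : ℂ) := by
  rw [uIoc_of_le zero_le_one] at hx
  rw [Complex.ofReal_mul, Complex.ofReal_cpow hx.1.le, Complex.ofReal_cpow (by linarith [hx.2])]
  push_cast
  norm_num

theorem betaKernel_intervalIntegrable {b : ℝ} (hb : 0 < b) :
    IntervalIntegrable (fun x : ℝ => x ^ (b - 1) * (1 - x) ^ (-(1 / 2) : ℝ))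
      MeasureTheory.volume 0 1 := by
  have h := (Complex.betaIntegral_convergent (u := (b : ℂ)) (v := ((1 / 2 : ℝ) : ℂ))
    (by simpa using hb) (by rw [Complex.ofReal_re]; norm_num)).norm
  refine h.congr fun x hx => ?_
  simp only [betaKernel_ofReal hx]
  rw [uIoc_of_le zero_le_one] at hx
  rw [Complex.norm_real, Real.norm_of_nonneg]
  exact mul_nonneg (Real.rpow_nonneg hx.1.le _) (Real.rpow_nonneg (by linarith [hx.2]) _)

/-- The complete integral is `B(b, 1/2)`; the prefactor `b` is absorbed by `Γ(b + 1) = b Γ(b)`. -/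
theorem incBeta_one {b : ℝ} (hb : 0 < b) :
    incBeta b 1 = Real.sqrt Real.pi * Real.Gamma (b + 1) / Real.Gamma (b + 1 / 2) := by
  have h1 := ProbabilityTheory.beta_eq_betaIntegralReal b (1 / 2) hb (by norm_num)
  have h2 : Complex.betaIntegral (b : ℂ) ((1 / 2 : ℝ) : ℂ)
      = ((∫ x in (0 : ℝ)..1, x ^ (b - 1) * (1 - x) ^ (-(1 / 2) : ℝ) : ℝ) : ℂ) := by
    rw [Complex.betaIntegral, ← intervalIntegral.integral_ofReal]
    refine intervalIntegral.integral_congr_ae (Eventually.of_forall fun x hx => ?_)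
    exact betaKernel_ofReal hx
  rw [h2, Complex.ofReal_re, ProbabilityTheory.beta, Real.Gamma_one_half_eq] at h1
  rw [incBeta, ← h1, Real.Gamma_add_one hb.ne']
  ring

theorem incBeta_zero (b : ℝ) : incBeta b 0 = 0 := by simp [incBeta]

theorem continuousOn_incBeta {b : ℝ} (hb : 0 < b) : ContinuousOn (incBeta b) (Icc 0 1) := by
  have h := intervalIntegral.continuousOn_primitive_interval (a := (0 : ℝ)) (b := 1)
    (f := fun x : ℝ => x ^ (b - 1) * (1 - x) ^ (-(1 / 2) : ℝ)) (μ := MeasureTheory.volume)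
    (by
      rw [uIcc_of_le zero_le_one, integrableOn_Icc_iff_integrableOn_Ioc]
      exact (intervalIntegrable_iff_integrableOn_Ioc_of_le zero_le_one).1
        (betaKernel_intervalIntegrable hb))
  rw [uIcc_of_le zero_le_one] at h
  exact continuousOn_const.mul h

theorem hasDerivAt_incBeta {b w : ℝ} (hb : 0 < b) (hw : w ∈ Ioo (0 : ℝ) 1) :
    HasDerivAt (incBeta b) (b * (w ^ (b - 1) * (1 - w) ^ (-(1 / 2) : ℝ))) w := by
  have hc : ContinuousOn (fun x : ℝ => x ^ (b - 1) * (1 - x) ^ (-(1 / 2) : ℝ)) (Ioo 0 1) := by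
    intro x hx
    refine ContinuousAt.continuousWithinAt (ContinuousAt.mul ?_ ?_)
    · exact continuousAt_id.rpow_const (Or.inl hx.1.ne')
    · exact (continuousAt_const.sub continuousAt_id).rpow_const
        (Or.inl (sub_pos.2 hx.2).ne')
  refine HasDerivAt.const_mul b (intervalIntegral.integral_hasDerivAt_right ?_ ?_ ?_)
  · refine (betaKernel_intervalIntegrable hb).mono_set ?_
    rw [uIcc_of_le hw.1.le, uIcc_of_le zero_le_one]
    exact Icc_subset_Icc le_rfl hw.2.le
  · exact hc.stronglyMeasurableAtFilter isOpen_Ioo w hw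
  · exact hc.continuousAt (isOpen_Ioo.mem_nhds hw)

theorem strictMonoOn_incBeta {b : ℝ} (hb : 0 < b) : StrictMonoOn (incBeta b) (Icc 0 1) := by
  refine strictMonoOn_of_deriv_pos (convex_Icc 0 1) (continuousOn_incBeta hb) fun w hw => ?_
  rw [interior_Icc] at hw
  rw [(hasDerivAt_incBeta hb hw).deriv]
  have := Real.rpow_pos_of_pos hw.1 (b - 1)
  have := Real.rpow_pos_of_pos (sub_pos.2 hw.2) (-(1 / 2))
  positivity

theorem bijOn_incBeta {b : ℝ} (hb : 0 < b) :
    BijOn (incBeta b) (Ioo 0 1) (Ioo 0 (incBeta b 1)) := by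
  have hm := strictMonoOn_incBeta hb
  refine ⟨fun w hw => ⟨?_, ?_⟩, (hm.mono Ioo_subset_Icc_self).injOn, ?_⟩
  · rw [← incBeta_zero b]
    exact hm (by simp) (Ioo_subset_Icc_self hw) hw.1
  · exact hm (Ioo_subset_Icc_self hw) (by simp) hw.2
  · have := intermediate_value_Ioo zero_le_one (continuousOn_incBeta hb)
    rwa [incBeta_zero] at this

/-! ### Hypergeometric form of the incomplete Beta integral -/

theorem hasSum_one_sub_rpow_neg_half {x : ℝ} (hx : x ∈ Ico (0 : ℝ) 1) :
    HasSum (fun n : ℕ => ((n.factorial : ℝ)⁻¹ * (ascPochhammer ℝ n).eval (1 / 2)) * x ^ n)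
      ((1 - x) ^ (-(1 / 2) : ℝ)) := by
  have h := (Real.one_add_rpow_hasFPowerSeriesOnBall_zero (a := -(1 / 2))).hasSum (y := -x)
    (by simpa [enorm_eq_nnnorm, ← NNReal.coe_lt_coe, abs_of_nonneg hx.1] using hx.2)
  rw [binomialSeries_eq_ordinaryHypergeometricSeries (b := (1 : ℝ))
    (fun k => by have : (0 : ℝ) ≤ k := k.cast_nonneg
                 linarith)] at h
  rw [zero_add, ← sub_eq_add_neg] at h
  have he : (fun n => ((ordinaryHypergeometricSeries ℝ (- -(1 / 2) : ℝ) 1 1).compContinuousLinearMap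
      (-ContinuousLinearMap.id ℝ ℝ) n) fun _ => -x) = fun n : ℕ =>
        ((n.factorial : ℝ)⁻¹ * (ascPochhammer ℝ n).eval (1 / 2)) * x ^ n := by
    funext n
    -- The binomial series is a `₂F₁` whose second and third parameters are both the dummy value 1,
    -- so their Pochhammer factors cancel.
    have h1 : (ascPochhammer ℝ n).eval 1 ≠ 0 := (ascPochhammer_pos n _ one_pos).ne'
    rw [FormalMultilinearSeries.compContinuousLinearMap_apply]
    have h2 : (⇑(-ContinuousLinearMap.id ℝ ℝ) ∘ fun _ : Fin n => -x) = fun _ => x := by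
      funext i
      simp
    rw [h2, ordinaryHypergeometricSeries_apply_eq, mul_inv_cancel_right₀ h1, neg_neg, smul_eq_mul]
  rwa [he] at h

theorem ascPochhammer_eval_div_succ {b : ℝ} (hb : 0 < b) (n : ℕ) :
    (ascPochhammer ℝ n).eval b * ((ascPochhammer ℝ n).eval (b + 1))⁻¹ = b / (b + n) := by
  have h1 : 0 < (ascPochhammer ℝ n).eval (b + 1) := ascPochhammer_pos n _ (by positivity)
  rw [← div_eq_mul_inv, div_eq_div_iff h1.ne' (by positivity)]
  induction n with
  | zero => simp
  | succ n ih =>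
    have h2 : 0 < (ascPochhammer ℝ n).eval (b + 1) := ascPochhammer_pos n _ (by positivity)
    have := ih h2
    rw [ascPochhammer_succ_eval, ascPochhammer_succ_eval]
    push_cast
    linear_combination (b + 1 + n) * this

/-- Expand `(1 - x)^(-1/2)` and integrate termwise: integrating `x^(n+b-1)` produces `1/(n+b)`,
which is the Pochhammer quotient of `b` and `b + 1` up to the factor `b`. All terms are nonnegative,
so summability of the integrals justifies the exchange. -/
theorem rpow_mul_ordinaryHypergeometric {b w : ℝ} (hb : 0 < b) (hw : w ∈ Ioo (0 : ℝ) 1) :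
    w ^ b * ordinaryHypergeometric (1 / 2 : ℝ) b (b + 1) w = incBeta b w := by
  set c : ℕ → ℝ := fun n => (n.factorial : ℝ)⁻¹ * (ascPochhammer ℝ n).eval (1 / 2) with hc
  have hc0 : ∀ n, 0 ≤ c n := fun n =>
    mul_nonneg (by positivity) (ascPochhammer_pos n _ (by norm_num)).le
  have hF : ∀ n : ℕ, ∀ x ∈ Ioc (0 : ℝ) w, 0 ≤ c n * x ^ (n + b - 1) := fun n x hx =>
    mul_nonneg (hc0 n) (Real.rpow_nonneg hx.1.le _)
  have hint : ∀ n : ℕ, ∫ x in Ioc (0 : ℝ) w, c n * x ^ (n + b - 1)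
      = c n * (w ^ b * w ^ n / (n + b)) := by
    intro n
    have hn : (0 : ℝ) < n + b := by positivity
    rw [← intervalIntegral.integral_of_le hw.1.le, intervalIntegral.integral_const_mul,
      integral_rpow (Or.inl (by linarith))]
    rw [sub_add_cancel, Real.zero_rpow hn.ne', sub_zero, Real.rpow_add hw.1, Real.rpow_natCast]
    ring
  have hsum := (hasSum_one_sub_rpow_neg_half (Ioo_subset_Ico_self hw)).summable
  have hnorm : ∀ n : ℕ, ∫ x in Ioc (0 : ℝ) w, ‖c n * x ^ (n + b - 1)‖
      = c n * (w ^ b * w ^ n / (n + b)) := fun n => by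
    rw [← hint n]
    refine MeasureTheory.setIntegral_congr_fun measurableSet_Ioc fun x hx => ?_
    exact Real.norm_of_nonneg (hF n x hx)
  have hs : Summable fun n : ℕ => c n * (w ^ b * w ^ n / (n + b)) := by
    -- Since `1/(n+b) ≤ 1/b`, the binomial series at `w` itself dominates.
    refine Summable.of_nonneg_of_le (fun n => ?_) (fun n => ?_) (hsum.mul_left (w ^ b / b))
    · have := hc0 n
      have := hw.1
      positivity
    · have h1 : w ^ b * w ^ n / (n + b) ≤ w ^ b * w ^ n / b := by
        have := hw.1
        gcongr
        simp
      calc c n * (w ^ b * w ^ n / (n + b)) ≤ c n * (w ^ b * w ^ n / b) :=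
            mul_le_mul_of_nonneg_left h1 (hc0 n)
        _ = w ^ b / b * (c n * w ^ n) := by ring
  have key := MeasureTheory.hasSum_integral_of_summable_integral_norm
    (μ := MeasureTheory.volume.restrict (Ioc 0 w)) (F := fun (n : ℕ) (x : ℝ) =>
      c n * x ^ (n + b - 1)) (fun n => by
        have hn : (0 : ℝ) ≤ n := n.cast_nonneg
        refine ((intervalIntegrable_iff_integrableOn_Ioc_of_le hw.1.le).1
          (intervalIntegral.intervalIntegrable_rpow' (by linarith))).const_mul (c n)) (by
        simpa only [hnorm] using hs)
  simp only [hint] at key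
  have hlim : ∫ x in Ioc (0 : ℝ) w, ∑' n : ℕ, c n * x ^ (n + b - 1)
      = ∫ x in (0 : ℝ)..w, x ^ (b - 1) * (1 - x) ^ (-(1 / 2) : ℝ) := by
    rw [intervalIntegral.integral_of_le hw.1.le]
    refine MeasureTheory.setIntegral_congr_fun measurableSet_Ioc fun x hx => ?_
    have h := (hasSum_one_sub_rpow_neg_half ⟨hx.1.le, hx.2.trans_lt hw.2⟩).mul_left (x ^ (b - 1))
    rw [← h.tsum_eq]
    refine tsum_congr fun n => ?_
    rw [add_sub_assoc, Real.rpow_add hx.1, Real.rpow_natCast]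
    ring
  rw [hlim] at key
  rw [incBeta, ← key.tsum_eq, ordinaryHypergeometric_eq_tsum, ← tsum_mul_left, ← tsum_mul_left]
  refine tsum_congr fun n => ?_
  rw [mul_assoc (_ * _), ascPochhammer_eval_div_succ hb, smul_eq_mul]
  simp only [hc, add_comm (n : ℝ) b]
  ring

/-- A primitive of a continuous function bounded below by a positive constant has a globally
defined differentiable inverse. -/
theorem exists_inverse_primitive {f : ℝ → ℝ} (hf : Continuous f) {c : ℝ} (hc : 0 < c)
    (hcf : ∀ x, c ≤ f x) :
    ∃ g : ℝ → ℝ, (∀ θ, g (∫ x in (0 : ℝ)..θ, f x) = θ) ∧ StrictMono g ∧ ∀ s, HasDerivAt g (f (g s))⁻¹ s := by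
  set P : ℝ → ℝ := fun θ => ∫ x in (0 : ℝ)..θ, f x with hP
  have hd : ∀ θ, HasDerivAt P (f θ) θ := fun θ => hf.integral_hasStrictDerivAt 0 θ |>.hasDerivAt
  have hpos : ∀ θ, 0 < f θ := fun θ => hc.trans_le (hcf θ)
  have hm : StrictMono P := strictMono_of_deriv_pos fun θ => by rw [(hd θ).deriv]; exact hpos θ
  have hcont : Continuous P := continuous_iff_continuousAt.2 fun θ => (hd θ).continuousAt
  have hi : ∀ a b, IntervalIntegrable f MeasureTheory.volume a b := hf.intervalIntegrable
  have hsurj : Function.Surjective P := by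
    refine hcont.surjective ?_ ?_
    · refine tendsto_atTop_mono' _ ?_ (tendsto_id.const_mul_atTop hc)
      filter_upwards [eventually_ge_atTop 0] with θ hθ
      have := intervalIntegral.integral_mono_on hθ (intervalIntegrable_const (c := c)) (hi 0 θ)
        (fun x _ => hcf x)
      simpa [mul_comm] using this
    · refine tendsto_atBot_mono' _ ?_ (tendsto_id.const_mul_atBot hc)
      filter_upwards [eventually_le_atBot 0] with θ hθ
      have := intervalIntegral.integral_mono_on hθ (intervalIntegrable_const (c := c)) (hi θ 0)
        (fun x _ => hcf x)
      simp only [intervalIntegral.integral_const, smul_eq_mul] at this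
      simp only [hP, id]
      rw [intervalIntegral.integral_symm]
      linarith
  let e := StrictMono.orderIsoOfSurjective P hm hsurj
  have he : ∀ θ, e θ = P θ := fun θ => rfl
  have hl : ∀ s, P (e.symm s) = s := fun s => by rw [← he, e.apply_symm_apply]
  refine ⟨e.symm, fun θ => e.symm_apply_apply θ, e.symm.strictMono, fun s => ?_⟩
  exact (hd _).of_local_left_inverse e.symm.continuous.continuousAt (hpos _).ne'
    (Eventually.of_forall hl)

/-! ### The angle parameter and the functions `F_α`, `G_α` -/

/-- The function `∫₀^θ cos^(1/α - 2)`: the velocity parameter `v` of the event at which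
`(t/τ)^α = cos θ`. -/
noncomputable def angleInt (α θ : ℝ) : ℝ := ∫ x in (0 : ℝ)..θ, Real.cos x ^ (1 / α - 2)

theorem continuousOn_cos_rpow (r : ℝ) :
    ContinuousOn (fun x => Real.cos x ^ r) (Ioo (-(Real.pi / 2)) (Real.pi / 2)) := fun _ hx =>
  (Real.continuous_cos.continuousAt.rpow_const
    (Or.inl (Real.cos_pos_of_mem_Ioo hx).ne')).continuousWithinAt

theorem hasStrictDerivAt_angleInt {α θ : ℝ} (hθ : θ ∈ Ioo (-(Real.pi / 2)) (Real.pi / 2)) :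
    HasStrictDerivAt (angleInt α) (Real.cos θ ^ (1 / α - 2)) θ := by
  have hc := continuousOn_cos_rpow (1 / α - 2)
  have h0 : (0 : ℝ) ∈ Ioo (-(Real.pi / 2)) (Real.pi / 2) := by
    constructor <;> linarith [Real.pi_pos]
  refine intervalIntegral.integral_hasStrictDerivAt_right ?_ ?_ ?_
  · exact (hc.mono ((convex_Ioo _ _).ordConnected.uIcc_subset h0 hθ)).intervalIntegrable
  · exact hc.stronglyMeasurableAtFilter isOpen_Ioo θ hθ
  · exact hc.continuousAt (isOpen_Ioo.mem_nhds hθ)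

theorem hasDerivAt_angleInt {α θ : ℝ} (hθ : θ ∈ Ioo (-(Real.pi / 2)) (Real.pi / 2)) :
    HasDerivAt (angleInt α) (Real.cos θ ^ (1 / α - 2)) θ :=
  (hasStrictDerivAt_angleInt hθ).hasDerivAt

theorem angleInt_zero (α : ℝ) : angleInt α 0 = 0 := by simp [angleInt]

theorem angleInt_pos {α θ : ℝ} (hθ : θ ∈ Ioo 0 (Real.pi / 2)) : 0 < angleInt α θ := by
  refine intervalIntegral.intervalIntegral_pos_of_pos_on ?_ (fun x hx => ?_) hθ.1
  · refine ((continuousOn_cos_rpow _).mono fun x hx => ?_).intervalIntegrable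
    rw [uIcc_of_le hθ.1.le] at hx
    constructor <;> linarith [hx.1, hx.2, hθ.2, Real.pi_pos]
  · refine Real.rpow_pos_of_pos (Real.cos_pos_of_mem_Ioo ?_) _
    constructor <;> linarith [hx.1, hx.2, hθ.2, Real.pi_pos]

/-- The substitution `w = cos² x`, phrased as constancy of a sum. The Beta kernel is singular at `w
= 1`, so at `x = 0` only continuity is used. -/
theorem incBeta_cos_sq {α θ : ℝ} (hα0 : 0 < α) (hα1 : α < 1) (hθ : θ ∈ Ico 0 (Real.pi / 2)) :
    incBeta ((1 - α) / (2 * α)) (Real.cos θ ^ 2)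
      = incBeta ((1 - α) / (2 * α)) 1 - (1 - α) / α * angleInt α θ := by
  set b := (1 - α) / (2 * α) with hb
  have hb0 : 0 < b := div_pos (by linarith) (by linarith)
  set H : ℝ → ℝ := fun x => incBeta b (Real.cos x ^ 2) + (1 - α) / α * angleInt α x with hH
  have hsub : Icc 0 θ ⊆ Ioo (-(Real.pi / 2)) (Real.pi / 2) := fun x hx => by
    constructor <;> linarith [hx.1, hx.2, hθ.2, Real.pi_pos]
  have hcont : ContinuousOn H (Icc 0 θ) := by
    refine ContinuousOn.add ?_ (continuousOn_const.mul fun x hx =>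
      (hasDerivAt_angleInt (hsub hx)).continuousAt.continuousWithinAt)
    refine (continuousOn_incBeta hb0).comp (by fun_prop) fun x _ => ⟨sq_nonneg _, ?_⟩
    exact Real.cos_sq_le_one x
  have hder : ∀ x ∈ Ioo 0 θ, HasDerivAt H 0 x := fun x hx => by
    have hc : 0 < Real.cos x := Real.cos_pos_of_mem_Ioo (hsub (Ioo_subset_Icc_self hx))
    have hs : 0 < Real.sin x := Real.sin_pos_of_mem_Ioo
      ⟨hx.1, by linarith [hx.2, hθ.2, Real.pi_pos]⟩
    have hsq := Real.sin_sq_add_cos_sq x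
    have hmem : Real.cos x ^ 2 ∈ Ioo (0 : ℝ) 1 := ⟨by positivity, by nlinarith⟩
    have h1 := (hasDerivAt_incBeta hb0 hmem).comp x ((Real.hasDerivAt_cos x).pow 2)
    have h2 := h1.add ((hasDerivAt_angleInt (α := α) (hsub (Ioo_subset_Icc_self hx))).const_mul
      ((1 - α) / α))
    refine h2.congr_deriv ?_
    have e1 : 1 - Real.cos x ^ 2 = Real.sin x ^ 2 := by linarith
    have e2 : (Real.sin x ^ 2) ^ (-(1 / 2) : ℝ) = (Real.sin x)⁻¹ := by
      rw [← Real.rpow_natCast, ← Real.rpow_mul hs.le, ← Real.rpow_neg_one]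
      norm_num
    have e3 : (Real.cos x ^ 2) ^ (b - 1) = Real.cos x ^ (1 / α - 2) / Real.cos x := by
      rw [← Real.rpow_natCast, ← Real.rpow_mul hc.le, ← Real.rpow_sub_one hc.ne']
      congr 1
      rw [hb]
      push_cast
      field_simp
      ring
    rw [e1, e2, e3, hb]
    field_simp
    push_cast
    ring
  have hconst : H θ = H 0 := by
    rcases hθ.1.eq_or_lt with h | h
    · rw [← h]
    · obtain ⟨x, hx, hx2⟩ := exists_hasDerivAt_eq_slope H (fun _ => 0) h hcont hder
      rw [eq_div_iff (by linarith)] at hx2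
      linarith
  simp only [hH, Real.cos_zero, angleInt_zero] at hconst
  norm_num at hconst
  linarith

theorem constC_eq_incBeta {α : ℝ} (hα0 : 0 < α) (hα1 : α < 1) :
    constC α = incBeta ((1 - α) / (2 * α)) 1 := by
  rw [incBeta_one (div_pos (by linarith) (by linarith)), constC]
  congr 3 <;> field_simp <;> ring

theorem funF_eq_incBeta {α z : ℝ} (hα0 : 0 < α) (hα1 : α < 1) (hz : z ∈ Ioo (0 : ℝ) 1) :
    funF α z = incBeta ((1 - α) / (2 * α)) (z ^ 2) := by
  have hb0 : 0 < (1 - α) / (2 * α) := div_pos (by linarith) (by linarith)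
  rw [← rpow_mul_ordinaryHypergeometric hb0 ⟨pow_pos hz.1 2, pow_lt_one₀ hz.1.le hz.2 two_ne_zero⟩,
    funF, ← Real.rpow_natCast z 2, ← Real.rpow_mul hz.1.le]
  congr 2 <;> field_simp <;> push_cast <;> ring

theorem bijOn_sq : BijOn (fun z : ℝ => z ^ 2) (Ioo 0 1) (Ioo 0 1) := by
  refine ⟨fun z hz => ⟨pow_pos hz.1 2, pow_lt_one₀ hz.1.le hz.2 two_ne_zero⟩,
    fun x hx y hy h => (pow_left_inj₀ hx.1.le hy.1.le two_ne_zero).1 h, fun w hw => ?_⟩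
  exact ⟨√w, ⟨Real.sqrt_pos.2 hw.1, by rw [Real.sqrt_lt' one_pos]; simpa using hw.2⟩,
    Real.sq_sqrt hw.1.le⟩

theorem bijOn_funF {α : ℝ} (hα0 : 0 < α) (hα1 : α < 1) :
    BijOn (funF α) (Ioo 0 1) (Ioo 0 (constC α)) := by
  rw [constC_eq_incBeta hα0 hα1]
  exact ((bijOn_incBeta (div_pos (by linarith) (by linarith))).comp bijOn_sq).congr
    fun z hz => (funF_eq_incBeta hα0 hα1 hz).symm

theorem cos_mem_Ioo {θ : ℝ} (hθ : θ ∈ Ioo 0 (Real.pi / 2)) : Real.cos θ ∈ Ioo (0 : ℝ) 1 := by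
  have h := Real.sin_pos_of_mem_Ioo ⟨hθ.1, by linarith [hθ.2, Real.pi_pos]⟩
  refine ⟨Real.cos_pos_of_mem_Ioo ⟨by linarith [hθ.1, Real.pi_pos], hθ.2⟩, ?_⟩
  nlinarith [Real.sin_sq_add_cos_sq θ, Real.cos_le_one θ]

theorem funF_cos {α θ : ℝ} (hα0 : 0 < α) (hα1 : α < 1) (hθ : θ ∈ Ioo 0 (Real.pi / 2)) :
    funF α (Real.cos θ) = constC α - (1 - α) / α * angleInt α θ := by
  rw [funF_eq_incBeta hα0 hα1 (cos_mem_Ioo hθ), constC_eq_incBeta hα0 hα1,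
    incBeta_cos_sq hα0 hα1 (Ioo_subset_Ico_self hθ)]

theorem funG_angleInt {α θ : ℝ} (hα0 : 0 < α) (hα1 : α < 1) (hθ : θ ∈ Ioo 0 (Real.pi / 2)) :
    funG α (angleInt α θ) = Real.cos θ ^ (1 / α) := by
  rw [funG, ← funF_cos hα0 hα1 hθ,
    (bijOn_funF hα0 hα1).injOn.leftInvOn_invFunOn (cos_mem_Ioo hθ)]

/-- The two bounds on `v` put `C_α - ((1-α)/α) v` into the range of `F_α`; the angle is the
arccosine of its preimage. -/
theorem exists_angleInt_eq {α v : ℝ} (hα0 : 0 < α) (hα1 : α < 1) (hv0 : 0 < v)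
    (hv : v < α / (1 - α) * constC α) : ∃ θ ∈ Ioo 0 (Real.pi / 2), angleInt α θ = v := by
  have h1 : 0 < 1 - α := by linarith
  have h3 : 0 < (1 - α) / α := by positivity
  have h2 : (1 - α) / α * (α / (1 - α) * constC α - v) = constC α - (1 - α) / α * v := by
    field_simp
  have h4 := mul_pos h3 (sub_pos.2 hv)
  rw [h2] at h4
  obtain ⟨z, hz, hzv⟩ := (bijOn_funF hα0 hα1).surjOn (show constC α - (1 - α) / α * v ∈ _ from
    ⟨h4, by nlinarith [mul_pos h3 hv0]⟩)
  have hθ : Real.arccos z ∈ Ioo 0 (Real.pi / 2) :=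
    ⟨Real.arccos_pos.2 hz.2, Real.arccos_lt_pi_div_two.2 hz.1⟩
  refine ⟨Real.arccos z, hθ, ?_⟩
  have := funF_cos hα0 hα1 hθ
  rw [Real.cos_arccos (by linarith [hz.1]) hz.2.le, hzv] at this
  have h5 : (1 - α) / α * (angleInt α (Real.arccos z) - v) = 0 := by linarith
  rcases mul_eq_zero.1 h5 with h | h
  · exact absurd h h3.ne'
  · linarith

/-! ### Geodesic and parallel transport equations in coordinates -/

theorem metric_inv {a : ℝ → ℝ} {x : Fin 2 → ℝ} (h : a (x 0) ≠ 0) :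
    (metric a x)⁻¹ = !![-1, 0; 0, (a (x 0) ^ 2)⁻¹] := by
  refine Matrix.inv_eq_right_inv ?_
  rw [metric, Matrix.mul_fin_two, Matrix.one_fin_two]
  simp [h]

theorem partialDeriv_metric {a : ℝ → ℝ} {a' : ℝ} {x : Fin 2 → ℝ} (h : HasDerivAt a a' (x 0))
    (i j k : Fin 2) : partialDeriv k (fun y => metric a y i j) x
      = if i = 1 ∧ j = 1 ∧ k = 0 then 2 * a (x 0) * a' else 0 := by
  have h2 : deriv (fun s => a s ^ 2) (x 0) = 2 * a (x 0) * a' := by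
    rw [(h.fun_pow 2).deriv]
    simp
  fin_cases i <;> fin_cases j <;> fin_cases k <;> simp [partialDeriv, metric, h2]

/-- The covariant derivative term along a curve, in coordinates. -/
theorem sum_christoffel {a : ℝ → ℝ} {a' : ℝ} {x : Fin 2 → ℝ} (h : HasDerivAt a a' (x 0))
    (h0 : a (x 0) ≠ 0) (v w : Fin 2 → ℝ) :
    (fun i => -∑ j, ∑ k, christoffel a x i j k * v j * w k)
      = ![-(a (x 0) * a' * v 1 * w 1), -(a' / a (x 0) * (v 0 * w 1 + v 1 * w 0))] := by
  funext i
  fin_cases i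
  · simp [christoffel, Fin.sum_univ_two, partialDeriv_metric h, metric_inv h0]
    left; left
    ring
  · simp [christoffel, Fin.sum_univ_two, partialDeriv_metric h, metric_inv h0]
    field_simp
    ring

theorem hasDerivWithinAt_fin_two {V : ℝ → Fin 2 → ℝ} {p q : ℝ} {S : Set ℝ} {s : ℝ} :
    HasDerivWithinAt V ![p, q] S s ↔
      HasDerivWithinAt (fun r => V r 0) p S s ∧ HasDerivWithinAt (fun r => V r 1) q S s := by
  rw [hasDerivWithinAt_pi, Fin.forall_fin_two]
  simp

theorem hasDerivAt_powerScale {α t : ℝ} (ht : 0 < t) :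
    HasDerivAt (powerScale α) (α * t ^ α / t) t := by
  refine (Real.hasDerivAt_rpow_const (Or.inl ht.ne')).congr_deriv ?_
  rw [Real.rpow_sub_one ht.ne', mul_div_assoc]

theorem isParallelAlong_powerScale_iff {α : ℝ} {γ γ' V : ℝ → Fin 2 → ℝ}
    (hγ : ∀ s ∈ Icc (0 : ℝ) 1, 0 < γ s 0) :
    IsParallelAlong (powerScale α) γ γ' V ↔ ∀ s ∈ Icc (0 : ℝ) 1,
      HasDerivWithinAt (fun r => V r 0)
        (-(α * (γ s 0 ^ α) ^ 2 / γ s 0 * γ' s 1 * V s 1)) (Icc 0 1) s ∧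
      HasDerivWithinAt (fun r => V r 1)
        (-(α / γ s 0 * (γ' s 0 * V s 1 + γ' s 1 * V s 0))) (Icc 0 1) s := by
  refine forall₂_congr fun s hs => ?_
  have ht := hγ s hs
  have hA : 0 < γ s 0 ^ α := Real.rpow_pos_of_pos ht _
  rw [sum_christoffel (hasDerivAt_powerScale ht) (by rw [powerScale]; exact hA.ne'),
    hasDerivWithinAt_fin_two, powerScale]
  refine Iff.and (iff_of_eq ?_) (iff_of_eq ?_)
  · congr 1
    field_simp
  · congr 1
    field_simp

theorem metricForm_eq (a : ℝ → ℝ) (x v w : Fin 2 → ℝ) :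
    metricForm a x v w = -(v 0 * w 0) + a (x 0) ^ 2 * v 1 * w 1 := by
  simp [metricForm, metric, Fin.sum_univ_two]

theorem modulus_smul_unitRadial {a : ℝ → ℝ} {τ : ℝ} (h : a τ ≠ 0) (r : ℝ) :
    modulus a (observer τ) (r • unitRadial a τ) = |r| := by
  rw [modulus, metricForm_eq, ← Real.sqrt_sq_eq_abs]
  congr 1
  simp [observer, unitRadial]
  field_simp

theorem eq_of_hasDerivWithinAt_zero {f : ℝ → ℝ}
    (hf : ∀ s ∈ Icc (0 : ℝ) 1, HasDerivWithinAt f 0 (Icc 0 1) s) {s : ℝ} (hs : s ∈ Icc (0 : ℝ) 1) :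
    f s = f 0 := by
  refine constant_of_has_deriv_right_zero (fun x hx => (hf x hx).continuousWithinAt)
    (fun x hx => ?_) s hs
  exact (hf x (Ico_subset_Icc_self hx)).mono_of_mem_nhdsWithin
    (mem_of_superset (Icc_mem_nhdsGE hx.2) (Icc_subset_Icc hx.1 le_rfl))

/-- The equations of an orthogonal geodesic from `(τ, 0)` to `(t₁, χ)` in coordinates. -/
theorem isFermiGeodesic_powerScale_iff {α τ t₁ χ : ℝ} {γ γ' : ℝ → Fin 2 → ℝ} :
    IsFermiGeodesic (powerScale α) τ (comoving χ t₁) γ γ' ↔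
      (∀ s ∈ Icc (0 : ℝ) 1, 0 < γ s 0 ∧
        HasDerivWithinAt (fun r => γ r 0) (γ' s 0) (Icc 0 1) s ∧
        HasDerivWithinAt (fun r => γ r 1) (γ' s 1) (Icc 0 1) s ∧
        HasDerivWithinAt (fun r => γ' r 0)
          (-(α * (γ s 0 ^ α) ^ 2 / γ s 0 * γ' s 1 * γ' s 1)) (Icc 0 1) s ∧
        HasDerivWithinAt (fun r => γ' r 1)
          (-(α / γ s 0 * (γ' s 0 * γ' s 1 + γ' s 1 * γ' s 0))) (Icc 0 1) s) ∧
      γ 0 0 = τ ∧ γ 0 1 = 0 ∧ γ 1 0 = t₁ ∧ γ 1 1 = χ ∧ γ' 0 0 = 0 := by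
  have hv : ∀ s, γ' s = ![γ' s 0, γ' s 1] := fun s => by
    funext i
    fin_cases i <;> rfl
  have ho : metricForm (powerScale α) (observer τ) (γ' 0) observerVelocity = 0 ↔ γ' 0 0 = 0 := by
    simp [metricForm_eq, observerVelocity]
  have hs : γ 0 = observer τ ↔ γ 0 0 = τ ∧ γ 0 1 = 0 := by
    simp [funext_iff, Fin.forall_fin_two, observer]
  have ht : γ 1 = comoving χ t₁ ↔ γ 1 0 = t₁ ∧ γ 1 1 = χ := by
    simp [funext_iff, Fin.forall_fin_two, comoving]
  constructor
  · rintro ⟨⟨h1, h2, h3⟩, h4, h5, h6⟩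
    rw [isParallelAlong_powerScale_iff h1] at h3
    refine ⟨fun s hsI => ⟨h1 s hsI, ?_⟩, (hs.1 h4).1, (hs.1 h4).2, (ht.1 h5).1, (ht.1 h5).2,
      ho.1 h6⟩
    have := h2 s hsI
    rw [hv s, hasDerivWithinAt_fin_two] at this
    exact ⟨this.1, this.2, h3 s hsI⟩
  · rintro ⟨h, h1, h2, h3, h4, h5⟩
    refine ⟨⟨fun s hs => (h s hs).1, fun s hs => ?_, ?_⟩, hs.2 ⟨h1, h2⟩, ht.2 ⟨h3, h4⟩, ho.2 h5⟩
    · rw [hv s, hasDerivWithinAt_fin_two]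
      exact ⟨(h s hs).2.1, (h s hs).2.2.1⟩
    · rw [isParallelAlong_powerScale_iff fun s hs => (h s hs).1]
      exact fun s hs => (h s hs).2.2.2

/-! ### First integrals of orthogonal geodesics -/

section geodesic

variable {α τ t₁ χ : ℝ} {γ γ' : ℝ → Fin 2 → ℝ}

theorem hasDerivWithinAt_rpow_comp {t : ℝ → ℝ} {p s : ℝ} {S : Set ℝ} (ht : 0 < t s)
    (h : HasDerivWithinAt t p S s) :
    HasDerivWithinAt (fun r => t r ^ α) (α * t s ^ α / t s * p) S s :=
  (hasDerivAt_powerScale (α := α) ht).comp_hasDerivWithinAt s h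

/-- Conservation law of the Killing field `∂/∂χ`. -/
theorem IsFermiGeodesic.momentum
    (hg : IsFermiGeodesic (powerScale α) τ (comoving χ t₁) γ γ') {s : ℝ} (hs : s ∈ Icc (0 : ℝ) 1) :
    (γ s 0 ^ α) ^ 2 * γ' s 1 = (τ ^ α) ^ 2 * γ' 0 1 := by
  obtain ⟨h, h0, -⟩ := isFermiGeodesic_powerScale_iff.1 hg
  rw [← h0]
  refine eq_of_hasDerivWithinAt_zero (f := fun s => (γ s 0 ^ α) ^ 2 * γ' s 1) (fun s hs => ?_) hs
  obtain ⟨hp, ht, -, -, hq⟩ := h s hs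
  refine (((hasDerivWithinAt_rpow_comp hp ht).fun_pow 2).fun_mul hq).congr_deriv ?_
  field_simp
  push_cast
  ring

/-- `g(γ', γ')` is constant; orthogonality to `u` removes the time component at `s = 0`. -/
theorem IsFermiGeodesic.energy
    (hg : IsFermiGeodesic (powerScale α) τ (comoving χ t₁) γ γ') {s : ℝ} (hs : s ∈ Icc (0 : ℝ) 1) :
    (γ s 0 ^ α) ^ 2 * γ' s 1 ^ 2 - γ' s 0 ^ 2 = (τ ^ α * γ' 0 1) ^ 2 := by
  obtain ⟨h, h0, -, -, -, h5⟩ := isFermiGeodesic_powerScale_iff.1 hg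
  have : (τ ^ α * γ' 0 1) ^ 2 = (γ 0 0 ^ α) ^ 2 * γ' 0 1 ^ 2 - γ' 0 0 ^ 2 := by
    rw [h0, h5]
    ring
  rw [this]
  refine eq_of_hasDerivWithinAt_zero (f := fun s => (γ s 0 ^ α) ^ 2 * γ' s 1 ^ 2 - γ' s 0 ^ 2)
    (fun s hs => ?_) hs
  obtain ⟨hpos, ht, -, hp, hq⟩ := h s hs
  refine ((((hasDerivWithinAt_rpow_comp hpos ht).fun_pow 2).fun_mul (hq.fun_pow 2)).fun_sub
    (hp.fun_pow 2)).congr_deriv ?_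
  field_simp
  push_cast
  ring

/-- For the homothetic field `X = t ∂/∂t + (1 - α) χ ∂/∂χ`, the product `g(X, γ')` grows at the
constant rate `g(γ', γ')`, and it vanishes at `s = 0`. This gives the length from endpoint data
alone. -/
theorem IsFermiGeodesic.virial
    (hg : IsFermiGeodesic (powerScale α) τ (comoving χ t₁) γ γ') {s : ℝ} (hs : s ∈ Icc (0 : ℝ) 1) :
    γ s 0 * γ' s 0 = (1 - α) * ((τ ^ α) ^ 2 * γ' 0 1) * γ s 1 - (τ ^ α * γ' 0 1) ^ 2 * s := by
  obtain ⟨h, h0, h1, -, -, h5⟩ := isFermiGeodesic_powerScale_iff.1 hg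
  have key := eq_of_hasDerivWithinAt_zero (f := fun s => γ s 0 * γ' s 0
    - (1 - α) * ((τ ^ α) ^ 2 * γ' 0 1) * γ s 1 + (τ ^ α * γ' 0 1) ^ 2 * s)
    (fun s hs => ?_) hs
  · simp only [h1, h5] at key
    linarith
  obtain ⟨hpos, ht, hx, hp, hq⟩ := h s hs
  refine (((ht.fun_mul hp).fun_sub (hx.const_mul _)).fun_add
    ((hasDerivWithinAt_id s _).const_mul _)).congr_deriv ?_
  rw [← hg.momentum hs, ← hg.energy hs]
  field_simp
  ring

/-- By momentum conservation `χ'` never changes sign, so a nonpositive initial value could not lead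
from 0 to `χ > 0`. -/
theorem IsFermiGeodesic.speed_pos (hτ : 0 < τ) (hχ : 0 < χ)
    (hg : IsFermiGeodesic (powerScale α) τ (comoving χ t₁) γ γ') : 0 < γ' 0 1 := by
  by_contra! hneg
  obtain ⟨h, h0, h1, h2, h3, h5⟩ := isFermiGeodesic_powerScale_iff.1 hg
  have hanti : AntitoneOn (fun s => γ s 1) (Icc 0 1) := by
    refine antitoneOn_of_hasDerivWithinAt_nonpos (f' := fun s => γ' s 1) (convex_Icc 0 1)
      (fun s hs => (h s hs).2.2.1.continuousWithinAt)
      (fun s hs => (h s (interior_subset hs)).2.2.1.mono interior_subset) fun s hs => ?_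
    have hA : 0 < γ s 0 ^ α := Real.rpow_pos_of_pos (h s (interior_subset hs)).1 _
    have hm := hg.momentum (interior_subset hs)
    have hT : 0 < τ ^ α := Real.rpow_pos_of_pos hτ _
    by_contra! hc
    have e1 : 0 < (γ s 0 ^ α) ^ 2 * γ' s 1 := by positivity
    have e2 : (τ ^ α) ^ 2 * γ' 0 1 ≤ 0 := mul_nonpos_of_nonneg_of_nonpos (by positivity) hneg
    linarith
  have := hanti (left_mem_Icc.2 zero_le_one) (right_mem_Icc.2 zero_le_one) zero_le_one
  simp only [h1, h3] at this
  linarith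

theorem IsFermiGeodesic.angular_pos (hτ : 0 < τ) (hχ : 0 < χ)
    (hg : IsFermiGeodesic (powerScale α) τ (comoving χ t₁) γ γ') {s : ℝ}
    (hs : s ∈ Icc (0 : ℝ) 1) : 0 < γ' s 1 := by
  have hA : 0 < γ s 0 ^ α := Real.rpow_pos_of_pos (hg.geodesic.pos s hs) _
  have hT : 0 < τ ^ α := Real.rpow_pos_of_pos hτ _
  have hm := hg.momentum hs
  have := hg.speed_pos hτ hχ
  by_contra! hc
  have e1 : 0 < (τ ^ α) ^ 2 * γ' 0 1 := by positivity
  have e2 : (γ s 0 ^ α) ^ 2 * γ' s 1 ≤ 0 := mul_nonpos_of_nonneg_of_nonpos (by positivity) hc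
  linarith

/-- The geodesic equation makes `t''` negative, and `t'` starts at 0. This fixes the sign of the
square root in `time_deriv`. -/
theorem IsFermiGeodesic.time_deriv_neg (hα0 : 0 < α) (hτ : 0 < τ) (hχ : 0 < χ)
    (hg : IsFermiGeodesic (powerScale α) τ (comoving χ t₁) γ γ') {s : ℝ}
    (hs : s ∈ Ioc (0 : ℝ) 1) : γ' s 0 < 0 := by
  obtain ⟨h, h0, h1, h2, h3, h5⟩ := isFermiGeodesic_powerScale_iff.1 hg
  have hanti : StrictAntiOn (fun s => γ' s 0) (Icc 0 1) := by
    refine strictAntiOn_of_hasDerivWithinAt_neg (convex_Icc 0 1)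
      (fun s hs => (h s hs).2.2.2.1.continuousWithinAt)
      (fun s hs => (h s (interior_subset hs)).2.2.2.1.mono interior_subset) fun s hs => ?_
    have hp := (h s (interior_subset hs)).1
    have hA : 0 < γ s 0 ^ α := Real.rpow_pos_of_pos hp _
    have hq := hg.angular_pos hτ hχ (interior_subset hs)
    have : 0 < α * (γ s 0 ^ α) ^ 2 / γ s 0 * γ' s 1 * γ' s 1 := by positivity
    linarith
  have := hanti (left_mem_Icc.2 zero_le_one) (Ioc_subset_Icc_self hs) hs.1
  simpa [h5] using this

theorem IsFermiGeodesic.time_lt (hα0 : 0 < α) (hτ : 0 < τ) (hχ : 0 < χ)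
    (hg : IsFermiGeodesic (powerScale α) τ (comoving χ t₁) γ γ') {s : ℝ}
    (hs : s ∈ Ioc (0 : ℝ) 1) : γ s 0 < τ := by
  obtain ⟨h, h0, -⟩ := isFermiGeodesic_powerScale_iff.1 hg
  have hanti : StrictAntiOn (fun s => γ s 0) (Icc 0 1) := by
    refine strictAntiOn_of_hasDerivWithinAt_neg (f' := fun s => γ' s 0) (convex_Icc 0 1)
      (fun s hs => (h s hs).2.1.continuousWithinAt)
      (fun s hs => (h s (interior_subset hs)).2.1.mono interior_subset) fun s hs => ?_
    rw [interior_Icc] at hs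
    exact hg.time_deriv_neg hα0 hτ hχ (Ioo_subset_Ioc_self hs)
  have := hanti (left_mem_Icc.2 zero_le_one) (Ioc_subset_Icc_self hs) hs.1
  simpa [h0] using this

/-- The time component of the velocity, in terms of the ratio `γ s 0 ^ α / τ ^ α`. -/
theorem IsFermiGeodesic.time_deriv (hα0 : 0 < α) (hτ : 0 < τ) (hχ : 0 < χ)
    (hg : IsFermiGeodesic (powerScale α) τ (comoving χ t₁) γ γ') {s : ℝ}
    (hs : s ∈ Ioc (0 : ℝ) 1) :
    γ' s 0 = -((τ ^ α) ^ 2 * γ' 0 1 / γ s 0 ^ α * √(1 - (γ s 0 ^ α / τ ^ α) ^ 2)) := by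
  have hsI := Ioc_subset_Icc_self hs
  have hA : 0 < γ s 0 ^ α := Real.rpow_pos_of_pos (hg.geodesic.pos s hsI) _
  have hT : 0 < τ ^ α := Real.rpow_pos_of_pos hτ _
  have hneg := hg.time_deriv_neg hα0 hτ hχ hs
  have hk := hg.speed_pos hτ hχ
  have hlt : γ s 0 ^ α < τ ^ α :=
    Real.rpow_lt_rpow (hg.geodesic.pos s hsI).le (hg.time_lt hα0 hτ hχ hs) hα0
  have hw : 0 ≤ 1 - (γ s 0 ^ α / τ ^ α) ^ 2 := by
    have : (γ s 0 ^ α / τ ^ α) ^ 2 < 1 :=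
      pow_lt_one₀ (by positivity) ((div_lt_one hT).2 hlt) two_ne_zero
    linarith
  have hsq : (-γ' s 0) ^ 2
      = ((τ ^ α) ^ 2 * γ' 0 1 / γ s 0 ^ α * √(1 - (γ s 0 ^ α / τ ^ α) ^ 2)) ^ 2 := by
    rw [mul_pow, Real.sq_sqrt hw]
    have e := hg.energy hsI
    have m : γ' s 1 = (τ ^ α) ^ 2 * γ' 0 1 / (γ s 0 ^ α) ^ 2 := by
      rw [← hg.momentum hsI]
      field_simp
    rw [m] at e
    field_simp at e ⊢
    linear_combination -e
  have := (pow_left_inj₀ (by linarith) (by positivity) two_ne_zero).1 hsq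
  linarith

/-- The integrated orbit equation: eliminating `s` between momentum and energy separates `t` from
`χ`, and the `t`-integral is an incomplete Beta integral in `(t/τ)^(2α)`. -/
theorem IsFermiGeodesic.incBeta_eq (hα0 : 0 < α) (hα1 : α < 1) (hτ : 0 < τ) (hχ : 0 < χ)
    (hg : IsFermiGeodesic (powerScale α) τ (comoving χ t₁) γ γ') :
    incBeta ((1 - α) / (2 * α)) ((t₁ ^ α / τ ^ α) ^ 2)
      = incBeta ((1 - α) / (2 * α)) 1 - (1 - α) * τ ^ α / τ * χ := by
  obtain ⟨h, h0, h1, h2, h3, h5⟩ := isFermiGeodesic_powerScale_iff.1 hg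
  set b := (1 - α) / (2 * α) with hb
  have hb0 : 0 < b := div_pos (by linarith) (by linarith)
  have hT : 0 < τ ^ α := Real.rpow_pos_of_pos hτ _
  have hle : ∀ s ∈ Icc (0 : ℝ) 1, γ s 0 ^ α / τ ^ α ∈ Icc (0 : ℝ) 1 := fun s hs => by
    have hp := (h s hs).1
    refine ⟨by positivity, (div_le_one hT).2 (Real.rpow_le_rpow hp.le ?_ hα0.le)⟩
    rcases hs.1.eq_or_lt with h | h
    · rw [← h, h0]
    · exact (hg.time_lt hα0 hτ hχ ⟨h, hs.2⟩).le
  have hWd : ∀ s ∈ Icc (0 : ℝ) 1, HasDerivWithinAt (fun r => (γ r 0 ^ α / τ ^ α) ^ 2)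
      (2 * α * (γ s 0 ^ α / τ ^ α) ^ 2 * γ' s 0 / γ s 0) (Icc 0 1) s := fun s hs => by
    obtain ⟨hpos, ht, -⟩ := h s hs
    refine (((hasDerivWithinAt_rpow_comp hpos ht).div_const _).fun_pow 2).congr_deriv ?_
    rw [Nat.add_one_sub_one, pow_one]
    push_cast
    field_simp
  set H : ℝ → ℝ := fun s => incBeta b ((γ s 0 ^ α / τ ^ α) ^ 2) + (1 - α) * τ ^ α / τ * γ s 1
    with hH
  have hcont : ContinuousOn H (Icc 0 1) := by
    refine ContinuousOn.add ?_ (continuousOn_const.mul fun s hs =>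
      (h s hs).2.2.1.continuousWithinAt)
    refine (continuousOn_incBeta hb0).comp (fun s hs => (hWd s hs).continuousWithinAt)
      fun s hs => ⟨sq_nonneg _, pow_le_one₀ (hle s hs).1 (hle s hs).2⟩
  have hder : ∀ s ∈ Ioo (0 : ℝ) 1, HasDerivAt H 0 s := fun s hs => by
    have hsI := Ioo_subset_Icc_self hs
    have hnhds := Icc_mem_nhds hs.1 hs.2
    have hpos := (h s hsI).1
    have hA : 0 < γ s 0 ^ α := Real.rpow_pos_of_pos hpos _
    have hu0 : 0 < γ s 0 ^ α / τ ^ α := by positivity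
    have hu1 : γ s 0 ^ α / τ ^ α < 1 := (div_lt_one hT).2
      (Real.rpow_lt_rpow hpos.le (hg.time_lt hα0 hτ hχ (Ioo_subset_Ioc_self hs)) hα0)
    have hmem : (γ s 0 ^ α / τ ^ α) ^ 2 ∈ Ioo (0 : ℝ) 1 :=
      ⟨by positivity, pow_lt_one₀ hu0.le hu1 two_ne_zero⟩
    have hd := ((hasDerivAt_incBeta hb0 hmem).comp s ((hWd s hsI).hasDerivAt hnhds)).add
      (((h s hsI).2.2.1.hasDerivAt hnhds).const_mul ((1 - α) * τ ^ α / τ))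
    refine hd.congr_deriv ?_
    have hr : 0 < 1 - (γ s 0 ^ α / τ ^ α) ^ 2 := sub_pos.2 hmem.2
    have hsqrt := Real.sqrt_pos.2 hr
    rw [hg.time_deriv hα0 hτ hχ (Ioo_subset_Ioc_self hs), Real.rpow_neg hr.le,
      ← Real.sqrt_eq_rpow, Real.rpow_sub_one hmem.1.ne']
    -- Here `2αb = 1 - α`, so the power is `(t/τ)^(1-α)`.
    have e1 : ((γ s 0 ^ α / τ ^ α) ^ 2) ^ b = γ s 0 / γ s 0 ^ α * (τ ^ α / τ) := by
      rw [← Real.div_rpow hpos.le hτ.le, ← Real.rpow_natCast, ← Real.rpow_mul (by positivity),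
        ← Real.rpow_mul (by positivity)]
      have : α * ((2 : ℕ) * b) = 1 - α := by
        rw [hb]
        push_cast
        field_simp
      rw [this, Real.rpow_sub (by positivity), Real.rpow_one,
        Real.div_rpow hpos.le hτ.le]
      field_simp
    have m : γ' s 1 = (τ ^ α) ^ 2 * γ' 0 1 / (γ s 0 ^ α) ^ 2 := by
      rw [← hg.momentum hsI]
      field_simp
    rw [e1, m, hb]
    generalize √(1 - (γ s 0 ^ α / τ ^ α) ^ 2) = R at *
    field_simp
    ring
  -- The mean value theorem needs differentiability only in the interior, which avoids the kernel's
  -- singularity at `s = 0`, where `t = τ`.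
  obtain ⟨x, hx, hx2⟩ := exists_hasDerivAt_eq_slope H (fun _ => 0) one_pos hcont hder
  rw [sub_zero, div_one] at hx2
  simp only [hH, h0, h1, h2, h3] at hx2
  rw [div_self hT.ne'] at hx2
  norm_num at hx2
  linarith

end geodesic

/-! ### Endpoint, length and parallel transport in terms of the angle -/

section geodesic

variable {α τ t₁ χ θ : ℝ} {γ γ' : ℝ → Fin 2 → ℝ}

/-- The endpoint has `t₁ > 0`, so the Beta integral in the orbit equation is strictly positive. -/
theorem IsFermiGeodesic.angle_lt (hα0 : 0 < α) (hα1 : α < 1) (hτ : 0 < τ) (hχ : 0 < χ)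
    (hg : IsFermiGeodesic (powerScale α) τ (comoving χ t₁) γ γ') :
    α * χ * τ ^ α / τ < α / (1 - α) * constC α := by
  have hb0 : 0 < (1 - α) / (2 * α) := div_pos (by linarith) (by linarith)
  have ht₁ : 0 < t₁ := by
    have := hg.geodesic.pos 1 (right_mem_Icc.2 zero_le_one)
    rwa [(isFermiGeodesic_powerScale_iff.1 hg).2.2.2.1] at this
  have hlt : t₁ < τ := by
    have := hg.time_lt hα0 hτ hχ (right_mem_Ioc.2 one_pos)
    rwa [(isFermiGeodesic_powerScale_iff.1 hg).2.2.2.1] at this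
  have hT : 0 < τ ^ α := Real.rpow_pos_of_pos hτ _
  have hA : 0 < t₁ ^ α := Real.rpow_pos_of_pos ht₁ _
  have hu : t₁ ^ α / τ ^ α ∈ Ioo (0 : ℝ) 1 :=
    ⟨by positivity, (div_lt_one hT).2 (Real.rpow_lt_rpow ht₁.le hlt hα0)⟩
  have h := ((bijOn_incBeta hb0).mapsTo (bijOn_sq.mapsTo hu)).1
  rw [hg.incBeta_eq hα0 hα1 hτ hχ, ← constC_eq_incBeta hα0 hα1] at h
  have h1 : 0 < 1 - α := by linarith
  have h2 : α / (1 - α) * constC α - α * χ * τ ^ α / τ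
      = α / (1 - α) * (constC α - (1 - α) * τ ^ α / τ * χ) := by
    field_simp
  have : 0 < α / (1 - α) := by positivity
  nlinarith [mul_pos this h]

theorem IsFermiGeodesic.time_target_rpow (hα0 : 0 < α) (hα1 : α < 1) (hτ : 0 < τ) (hχ : 0 < χ)
    (hθ : θ ∈ Ioo 0 (Real.pi / 2)) (hv : angleInt α θ = α * χ * τ ^ α / τ)
    (hg : IsFermiGeodesic (powerScale α) τ (comoving χ t₁) γ γ') :
    t₁ ^ α = τ ^ α * Real.cos θ := by
  have hb0 : 0 < (1 - α) / (2 * α) := div_pos (by linarith) (by linarith)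
  have ht₁ : 0 < t₁ := by
    have := hg.geodesic.pos 1 (right_mem_Icc.2 zero_le_one)
    rwa [(isFermiGeodesic_powerScale_iff.1 hg).2.2.2.1] at this
  have hlt : t₁ < τ := by
    have := hg.time_lt hα0 hτ hχ (right_mem_Ioc.2 one_pos)
    rwa [(isFermiGeodesic_powerScale_iff.1 hg).2.2.2.1] at this
  have hT : 0 < τ ^ α := Real.rpow_pos_of_pos hτ _
  have hA : 0 < t₁ ^ α := Real.rpow_pos_of_pos ht₁ _
  have hu : t₁ ^ α / τ ^ α ∈ Ioo (0 : ℝ) 1 :=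
    ⟨by positivity, (div_lt_one hT).2 (Real.rpow_lt_rpow ht₁.le hlt hα0)⟩
  have h : incBeta ((1 - α) / (2 * α)) ((t₁ ^ α / τ ^ α) ^ 2)
      = incBeta ((1 - α) / (2 * α)) (Real.cos θ ^ 2) := by
    rw [hg.incBeta_eq hα0 hα1 hτ hχ, incBeta_cos_sq hα0 hα1 (Ioo_subset_Ico_self hθ), hv]
    field_simp
  have := ((bijOn_incBeta hb0).comp bijOn_sq).injOn hu (cos_mem_Ioo hθ) h
  rw [← this]
  field_simp

theorem IsFermiGeodesic.time_target (hα0 : 0 < α) (hα1 : α < 1) (hτ : 0 < τ) (hχ : 0 < χ)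
    (hθ : θ ∈ Ioo 0 (Real.pi / 2)) (hv : angleInt α θ = α * χ * τ ^ α / τ)
    (hg : IsFermiGeodesic (powerScale α) τ (comoving χ t₁) γ γ') :
    t₁ = τ * Real.cos θ ^ (1 / α) := by
  have ht₁ : 0 < t₁ := by
    have := hg.geodesic.pos 1 (right_mem_Icc.2 zero_le_one)
    rwa [(isFermiGeodesic_powerScale_iff.1 hg).2.2.2.1] at this
  have h := hg.time_target_rpow hα0 hα1 hτ hχ hθ hv
  rw [← Real.rpow_rpow_inv ht₁.le hα0.ne', h,
    Real.mul_rpow (Real.rpow_nonneg hτ.le _) (cos_mem_Ioo hθ).1.le,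
    Real.rpow_rpow_inv hτ.le hα0.ne', one_div]

theorem IsFermiGeodesic.time_deriv_target (hα0 : 0 < α) (hα1 : α < 1) (hτ : 0 < τ) (hχ : 0 < χ)
    (hθ : θ ∈ Ioo 0 (Real.pi / 2)) (hv : angleInt α θ = α * χ * τ ^ α / τ)
    (hg : IsFermiGeodesic (powerScale α) τ (comoving χ t₁) γ γ') :
    γ' 1 0 = -(τ ^ α * γ' 0 1 * Real.sin θ / Real.cos θ) := by
  have hT : 0 < τ ^ α := Real.rpow_pos_of_pos hτ _
  have hc := (cos_mem_Ioo hθ).1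
  have hs : 0 < Real.sin θ := Real.sin_pos_of_mem_Ioo ⟨hθ.1, by linarith [hθ.2, Real.pi_pos]⟩
  rw [hg.time_deriv hα0 hτ hχ (right_mem_Ioc.2 one_pos),
    (isFermiGeodesic_powerScale_iff.1 hg).2.2.2.1, hg.time_target_rpow hα0 hα1 hτ hχ hθ hv,
    mul_div_cancel_left₀ _ hT.ne', ← Real.sin_sq, Real.sqrt_sq hs.le]
  field_simp

/-- The Fermi distance of the event at which `(t/τ)^α = cos θ`. -/
noncomputable def fermiDist (α τ χ θ : ℝ) : ℝ :=
  τ * (Real.cos θ ^ (1 / α) * Real.sin θ / Real.cos θ) + (1 - α) * τ ^ α * χ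

/-- The virial identity at `s = 1` is the claim multiplied by the speed, which is positive and
cancels. -/
theorem IsFermiGeodesic.speed_eq (hα0 : 0 < α) (hα1 : α < 1) (hτ : 0 < τ) (hχ : 0 < χ)
    (hθ : θ ∈ Ioo 0 (Real.pi / 2)) (hv : angleInt α θ = α * χ * τ ^ α / τ)
    (hg : IsFermiGeodesic (powerScale α) τ (comoving χ t₁) γ γ') :
    τ ^ α * γ' 0 1 = fermiDist α τ χ θ := by
  have hT : 0 < τ ^ α := Real.rpow_pos_of_pos hτ _
  have hk := hg.speed_pos hτ hχ
  have hc := (cos_mem_Ioo hθ).1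
  have h := hg.virial (right_mem_Icc.2 zero_le_one)
  rw [(isFermiGeodesic_powerScale_iff.1 hg).2.2.2.1, (isFermiGeodesic_powerScale_iff.1 hg).2.2.2.2.1,
    hg.time_deriv_target hα0 hα1 hτ hχ hθ hv, hg.time_target hα0 hα1 hτ hχ hθ hv] at h
  have hr : τ ^ α * γ' 0 1 ≠ 0 := by positivity
  refine mul_left_cancel₀ hr ?_
  rw [fermiDist]
  linear_combination h

theorem IsFermiGeodesic.length_eq (hτ : 0 < τ) (hχ : 0 < χ)
    (hg : IsFermiGeodesic (powerScale α) τ (comoving χ t₁) γ γ') :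
    ∫ r in (0 : ℝ)..1, modulus (powerScale α) (γ r) (γ' r) = τ ^ α * γ' 0 1 := by
  have hT : 0 < τ ^ α := Real.rpow_pos_of_pos hτ _
  have hk := hg.speed_pos hτ hχ
  rw [intervalIntegral.integral_congr (g := fun _ => τ ^ α * γ' 0 1)]
  · simp
  · intro s hs
    rw [uIcc_of_le zero_le_one] at hs
    simp only [modulus, metricForm_eq]
    rw [← Real.sqrt_sq (show 0 ≤ τ ^ α * γ' 0 1 by positivity),
      ← hg.energy hs, powerScale]
    congr 1
    ring

/-- A parallel field is determined at `s = 0` by its value at `s = 1`. -/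
theorem IsFermiGeodesic.parallel_conserved {V : ℝ → Fin 2 → ℝ}
    (hg : IsFermiGeodesic (powerScale α) τ (comoving χ t₁) γ γ')
    (hV : IsParallelAlong (powerScale α) γ γ' V) {s : ℝ} (hs : s ∈ Icc (0 : ℝ) 1) :
    γ s 0 ^ α * (V s 0 * γ' s 1 - V s 1 * γ' s 0) = τ ^ α * γ' 0 1 * V 0 0 ∧
      (γ s 0 ^ α) ^ 2 * V s 1 * γ' s 1 - V s 0 * γ' s 0 = (τ ^ α) ^ 2 * γ' 0 1 * V 0 1 := by
  obtain ⟨h, h0, -, -, -, h5⟩ := isFermiGeodesic_powerScale_iff.1 hg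
  rw [isParallelAlong_powerScale_iff hg.geodesic.pos] at hV
  constructor
  · have key := eq_of_hasDerivWithinAt_zero
      (f := fun s => γ s 0 ^ α * (V s 0 * γ' s 1 - V s 1 * γ' s 0)) (fun s hs => ?_) hs
    · rw [key, h0, h5]
      ring
    obtain ⟨hpos, ht, -, hp, hq⟩ := h s hs
    obtain ⟨hV0, hV1⟩ := hV s hs
    refine ((hasDerivWithinAt_rpow_comp hpos ht).fun_mul
      ((hV0.fun_mul hq).fun_sub (hV1.fun_mul hp))).congr_deriv ?_
    field_simp
    ring
  · have key := eq_of_hasDerivWithinAt_zero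
      (f := fun s => (γ s 0 ^ α) ^ 2 * V s 1 * γ' s 1 - V s 0 * γ' s 0) (fun s hs => ?_) hs
    · rw [key, h0, h5]
      ring
    obtain ⟨hpos, ht, -, hp, hq⟩ := h s hs
    obtain ⟨hV0, hV1⟩ := hV s hs
    refine (((((hasDerivWithinAt_rpow_comp hpos ht).fun_pow 2).fun_mul hV1).fun_mul hq).fun_sub
      (hV0.fun_mul hp)).congr_deriv ?_
    field_simp
    push_cast
    ring

/-- The two conserved quantities form a linear system that is diagonal at `s = 0`, because `γ' 0` is
purely spatial. The result is `u` boosted with velocity `sin θ`. -/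
theorem IsFermiGeodesic.parallel_source (hα0 : 0 < α) (hα1 : α < 1) (hτ : 0 < τ) (hχ : 0 < χ)
    (hθ : θ ∈ Ioo 0 (Real.pi / 2)) (hv : angleInt α θ = α * χ * τ ^ α / τ) {V : ℝ → Fin 2 → ℝ}
    (hg : IsFermiGeodesic (powerScale α) τ (comoving χ t₁) γ γ')
    (hV : IsParallelAlong (powerScale α) γ γ' V) (hV1 : V 1 = ![1, 0]) :
    V 0 = (1 / Real.cos θ) • (observerVelocity + Real.sin θ • unitRadial (powerScale α) τ) := by
  have hT : 0 < τ ^ α := Real.rpow_pos_of_pos hτ _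
  have hk := hg.speed_pos hτ hχ
  have hc := (cos_mem_Ioo hθ).1
  have hI := right_mem_Icc.2 (zero_le_one (α := ℝ))
  have hm := hg.momentum hI
  obtain ⟨h1, h2⟩ := hg.parallel_conserved hV hI
  rw [(isFermiGeodesic_powerScale_iff.1 hg).2.2.2.1, hg.time_target_rpow hα0 hα1 hτ hχ hθ hv]
    at hm h1 h2
  rw [hg.time_deriv_target hα0 hα1 hτ hχ hθ hv] at h1 h2
  simp only [hV1, Matrix.cons_val_zero, Matrix.cons_val_one] at h1 h2
  have hq : γ' 1 1 = γ' 0 1 / Real.cos θ ^ 2 := by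
    field_simp at hm ⊢
    linarith
  rw [hq] at h1 h2
  have e0 : V 0 0 = 1 / Real.cos θ := by
    field_simp at h1 ⊢
    linarith
  have e1 : V 0 1 = 1 / Real.cos θ * (Real.sin θ * (1 / τ ^ α)) := by
    field_simp at h2 ⊢
    linarith
  funext i
  fin_cases i
  · simpa [observerVelocity, unitRadial] using e0
  · simpa [observerVelocity, unitRadial, powerScale] using e1

end geodesic

/-! ### Construction of the orthogonal geodesic -/

section existence

variable {α τ χ θ : ℝ}

theorem exists_isFermiGeodesic (hα0 : 0 < α) (hτ : 0 < τ)
    (hθ : θ ∈ Ioo 0 (Real.pi / 2)) (hv : angleInt α θ = α * χ * τ ^ α / τ) :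
    ∃ γ γ' V, IsFermiGeodesic (powerScale α) τ (comoving χ (τ * Real.cos θ ^ (1 / α))) γ γ' ∧
      IsParallelAlong (powerScale α) γ γ' V ∧ V 1 = ![1, 0] := by
  have hT : 0 < τ ^ α := Real.rpow_pos_of_pos hτ _
  have hc := (cos_mem_Ioo hθ).1
  -- Truncating at `cos θ` changes nothing on `[0, θ]` but bounds the integrand below on all of `ℝ`,
  -- so that its primitive has a global inverse.
  set m : ℝ → ℝ := fun x => max (Real.cos x) (Real.cos θ) ^ (1 / α) with hm
  have hmc : Continuous m := Continuous.rpow_const (by fun_prop) fun x =>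
    Or.inl (hc.trans_le (le_max_right _ _)).ne'
  have hmle : ∀ x, Real.cos θ ^ (1 / α) ≤ m x := fun x =>
    Real.rpow_le_rpow hc.le (le_max_right _ _) (by positivity)
  have hc' : 0 < Real.cos θ ^ (1 / α) := Real.rpow_pos_of_pos hc _
  have hJ : 0 < ∫ x in (0 : ℝ)..θ, m x := intervalIntegral.intervalIntegral_pos_of_pos
    (hmc.intervalIntegrable _ _) (fun x => hc'.trans_le (hmle x)) hθ.1
  -- The length of the geodesic, chosen so that the angle `g` runs from 0 to `θ` over `[0, 1]`.
  set r : ℝ := τ / α * ∫ x in (0 : ℝ)..θ, m x with hr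
  have hr0 : 0 < r := by positivity
  have hf0 : 0 < τ / (α * r) := by positivity
  obtain ⟨g, hgl, hmono, hgd⟩ := exists_inverse_primitive (f := fun x => τ / (α * r) * m x)
    (continuous_const.mul hmc) (mul_pos hf0 hc')
    (fun x => mul_le_mul_of_nonneg_left (hmle x) hf0.le)
  have hg0 : g 0 = 0 := by simpa using hgl 0
  have hg1 : g 1 = θ := by
    have := hgl θ
    rw [intervalIntegral.integral_const_mul] at this
    rwa [show τ / (α * r) * ∫ x in (0 : ℝ)..θ, m x = 1 by
      rw [hr]
      field_simp] at this
  have hmem : ∀ s ∈ Icc (0 : ℝ) 1, g s ∈ Icc 0 θ := fun s hs =>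
    ⟨hg0 ▸ hmono.monotone hs.1, hg1 ▸ hmono.monotone hs.2⟩
  have hcos : ∀ s ∈ Icc (0 : ℝ) 1, 0 < Real.cos (g s) := fun s hs =>
    Real.cos_pos_of_mem_Ioo ⟨by linarith [(hmem s hs).1, Real.pi_pos],
      (hmem s hs).2.trans_lt hθ.2⟩
  have hgd' : ∀ s ∈ Icc (0 : ℝ) 1,
      HasDerivAt g (α * r / (τ * Real.cos (g s) ^ (1 / α))) s := fun s hs => by
    refine (hgd s).congr_deriv ?_
    have : Real.cos θ ≤ Real.cos (g s) := Real.cos_le_cos_of_nonneg_of_le_pi (hmem s hs).1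
      (by linarith [hθ.2, Real.pi_pos]) (hmem s hs).2
    simp only [hm]
    rw [max_eq_left this]
    field_simp
  have hXα : ∀ s ∈ Icc (0 : ℝ) 1,
      (τ * Real.cos (g s) ^ (1 / α)) ^ α = τ ^ α * Real.cos (g s) := fun s hs => by
    rw [Real.mul_rpow hτ.le (Real.rpow_nonneg (hcos s hs).le _), one_div,
      Real.rpow_inv_rpow (hcos s hs).le hα0.ne']
  have hpos : ∀ s ∈ Icc (0 : ℝ) 1, 0 < τ * Real.cos (g s) ^ (1 / α) := fun s hs =>
    mul_pos hτ (Real.rpow_pos_of_pos (hcos s hs) _)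
  set γ : ℝ → Fin 2 → ℝ := fun s =>
    ![τ * Real.cos (g s) ^ (1 / α), τ / (α * τ ^ α) * angleInt α (g s)] with hγ
  set γ' : ℝ → Fin 2 → ℝ := fun s =>
    ![-(r * Real.sin (g s) / Real.cos (g s)), r / (τ ^ α * Real.cos (g s) ^ 2)] with hγ'
  -- `V = (e₀ + sin θ e₁) / cos θ`, where `e₁ = γ'/r` and `e₀` is the future unit normal to `e₁`;
  -- both are parallel, and the coefficients are those of `∂/∂t` at `s = 1`.
  set V : ℝ → Fin 2 → ℝ := fun s =>
    ![(1 - Real.sin θ * Real.sin (g s)) / (Real.cos θ * Real.cos (g s)),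
      (Real.sin θ - Real.sin (g s)) / (τ ^ α * Real.cos θ * Real.cos (g s) ^ 2)] with hV
  have hgeo : IsFermiGeodesic (powerScale α) τ (comoving χ (τ * Real.cos θ ^ (1 / α))) γ γ' := by
    rw [isFermiGeodesic_powerScale_iff]
    refine ⟨fun s hs => ?_, ?_, ?_, ?_, ?_, ?_⟩
    · have hcs := hcos s hs
      have hX : 0 < Real.cos (g s) ^ (1 / α) := Real.rpow_pos_of_pos hcs _
      have hsc := Real.sin_sq_add_cos_sq (g s)
      simp only [hγ, hγ', Matrix.cons_val_zero, Matrix.cons_val_one]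
      have hdc := (hgd' s hs).cos
      have hds := (hgd' s hs).sin
      refine ⟨hpos s hs, ?_, ?_, ?_, ?_⟩
      · refine (((hdc.rpow_const (p := 1 / α) (Or.inl hcs.ne')).const_mul τ).congr_deriv
          ?_).hasDerivWithinAt
        rw [Real.rpow_sub_one hcs.ne']
        field_simp
      · refine ((((hasDerivAt_angleInt (α := α) ⟨by linarith [(hmem s hs).1, Real.pi_pos],
          (hmem s hs).2.trans_lt hθ.2⟩).comp s (hgd' s hs)).const_mul _).congr_deriv
          ?_).hasDerivWithinAt
        rw [Real.rpow_sub hcs, Real.rpow_two]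
        field_simp
      · refine (((hds.const_mul r).fun_div hdc hcs.ne').fun_neg.congr_deriv ?_).hasDerivWithinAt
        rw [hXα s hs]
        field_simp
        linear_combination (-1) * hsc
      · refine (((hasDerivAt_const s r).fun_div ((hdc.fun_pow 2).const_mul (τ ^ α))
          (by positivity)).congr_deriv ?_).hasDerivWithinAt
        rw [Nat.add_one_sub_one, pow_one]
        push_cast
        field_simp
        ring
    · simp [hγ, hg0]
    · simp [hγ, hg0, angleInt_zero]
    · simp [hγ, hg1]
    · have : τ / (α * τ ^ α) * angleInt α θ = χ := by
        rw [hv]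
        field_simp
      simpa [hγ, hg1] using this
    · simp [hγ', hg0]
  refine ⟨γ, γ', V, hgeo, ?_, ?_⟩
  · rw [isParallelAlong_powerScale_iff hgeo.geodesic.pos]
    intro s hs
    have hcs := hcos s hs
    have hX : 0 < Real.cos (g s) ^ (1 / α) := Real.rpow_pos_of_pos hcs _
    have hsc := Real.sin_sq_add_cos_sq (g s)
    simp only [hγ, hγ', hV, Matrix.cons_val_zero, Matrix.cons_val_one]
    have hdc := (hgd' s hs).cos
    have hds := (hgd' s hs).sin
    rw [hXα s hs]
    constructor
    · refine (((hds.const_mul (Real.sin θ)).const_sub 1).fun_div (hdc.const_mul (Real.cos θ))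
        (by positivity) |>.congr_deriv ?_).hasDerivWithinAt
      field_simp
      linear_combination (-Real.sin θ) * hsc
    · refine ((hds.const_sub (Real.sin θ)).fun_div ((hdc.fun_pow 2).const_mul (τ ^ α * Real.cos θ))
        (by positivity) |>.congr_deriv ?_).hasDerivWithinAt
      rw [Nat.add_one_sub_one, pow_one]
      push_cast
      field_simp
      linear_combination -hsc
  · have hsc := Real.sin_sq_add_cos_sq θ
    simp only [hV, hg1, sub_self, zero_div]
    congr 1
    field_simp
    linarith

end existence

/-! ### Simultaneity, Fermi distance and the two velocities -/

variable {α τ χ θ : ℝ}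

theorem fermiSimultaneous_comoving_iff (hα0 : 0 < α) (hα1 : α < 1) (hτ : 0 < τ) (hχ : 0 < χ)
    (hθ : θ ∈ Ioo 0 (Real.pi / 2)) (hv : angleInt α θ = α * χ * τ ^ α / τ) (t : ℝ) :
    FermiSimultaneous (powerScale α) τ (comoving χ t) ↔ t = τ * Real.cos θ ^ (1 / α) := by
  constructor
  · rintro ⟨γ, γ', hg⟩
    exact hg.time_target hα0 hα1 hτ hχ hθ hv
  · rintro rfl
    obtain ⟨γ, γ', V, hg, -⟩ := exists_isFermiGeodesic hα0 hτ hθ hv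
    exact ⟨γ, γ', hg⟩

theorem isFermiDistance_comoving_iff (hα0 : 0 < α) (hα1 : α < 1) (hτ : 0 < τ) (hχ : 0 < χ)
    (hθ : θ ∈ Ioo 0 (Real.pi / 2)) (hv : angleInt α θ = α * χ * τ ^ α / τ) (d : ℝ) :
    IsFermiDistance (powerScale α) τ (comoving χ) d ↔ d = fermiDist α τ χ θ := by
  constructor
  · rintro ⟨s, γ, γ', hg, rfl⟩
    rw [hg.length_eq hτ hχ, hg.speed_eq hα0 hα1 hτ hχ hθ hv]
  · rintro rfl
    obtain ⟨γ, γ', V, hg, -⟩ := exists_isFermiGeodesic hα0 hτ hθ hv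
    refine ⟨_, γ, γ', hg, ?_⟩
    rw [hg.length_eq hτ hχ, hg.speed_eq hα0 hα1 hτ hχ hθ hv]

theorem deriv_comoving (χ s : ℝ) : deriv (comoving χ) s = ![1, 0] := by
  refine HasDerivAt.deriv (hasDerivAt_pi.2 fun i => ?_)
  fin_cases i
  · simpa [comoving] using hasDerivAt_id' s
  · simpa [comoving] using hasDerivAt_const s χ

theorem isKinematicVelocity_comoving_iff (hα0 : 0 < α) (hα1 : α < 1) (hτ : 0 < τ) (hχ : 0 < χ)
    (hθ : θ ∈ Ioo 0 (Real.pi / 2)) (hv : angleInt α θ = α * χ * τ ^ α / τ) (w : Fin 2 → ℝ) :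
    IsKinematicVelocity (powerScale α) τ (comoving χ) w ↔
      w = Real.sin θ • unitRadial (powerScale α) τ := by
  have hc := (cos_mem_Ioo hθ).1
  constructor
  · rintro ⟨s, γ, γ', V, hg, hV, hV1, hw, c, hc0⟩
    rw [deriv_comoving] at hV1
    rw [hg.parallel_source hα0 hα1 hτ hχ hθ hv hV hV1] at hc0
    have hw0 : w 0 = 0 := by simpa [metricForm_eq, observerVelocity] using hw
    have h0 := congrFun hc0 0
    rw [Pi.smul_apply, Pi.smul_apply, Pi.add_apply, Pi.add_apply, hw0] at h0
    simp only [observerVelocity, unitRadial, Pi.smul_apply, Matrix.cons_val_zero, smul_eq_mul,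
      mul_zero, add_zero, mul_one] at h0
    -- As `w` has no time component, that component alone forces `c = 1 / cos θ`.
    rw [← h0] at hc0
    exact (add_left_cancel (smul_right_injective _ (one_div_ne_zero hc.ne') hc0)).symm
  · rintro rfl
    obtain ⟨γ, γ', V, hg, hV, hV1⟩ := exists_isFermiGeodesic hα0 hτ hθ hv
    refine ⟨_, γ, γ', V, hg, hV, by rw [hV1, deriv_comoving], ?_, _,
      hg.parallel_source hα0 hα1 hτ hχ hθ hv hV hV1⟩
    simp [metricForm_eq, observerVelocity, unitRadial]

theorem hasDerivAt_angleParam (hτ : 0 < τ) :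
    HasDerivAt (fun x => α * χ * x ^ α / x) (-((1 - α) * (α * χ * τ ^ α / τ) / τ)) τ := by
  refine (((hasDerivAt_powerScale (α := α) hτ).const_mul (α * χ)).fun_div (hasDerivAt_id τ)
    hτ.ne').congr_deriv ?_
  simp only [id, powerScale]
  field_simp
  ring

/-- The prescribed derivative of `φ` is the one obtained by differentiating `angleInt α (φ τ) =
v(τ)`, using `dv/dτ = -(1 - α) v / τ`. -/
theorem hasDerivAt_fermiDist_comp (hα0 : 0 < α) (hτ : 0 < τ) (hθ : θ ∈ Ioo 0 (Real.pi / 2))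
    (hv : angleInt α θ = α * χ * τ ^ α / τ) {φ : ℝ → ℝ} (hφ0 : φ τ = θ)
    (hφ : HasDerivAt φ
      ((Real.cos θ ^ (1 / α - 2))⁻¹ * -((1 - α) * (α * χ * τ ^ α / τ) / τ)) τ) :
    HasDerivAt (fun x => fermiDist α x χ (φ x))
      (Real.cos θ ^ (1 / α) * Real.sin θ / Real.cos θ
        + (1 - α) / α * Real.sin θ ^ 2 * angleInt α θ) τ := by
  have hc := (cos_mem_Ioo hθ).1
  have hX : 0 < Real.cos θ ^ (1 / α) := Real.rpow_pos_of_pos hc _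
  have hc' : Real.cos (φ τ) ≠ 0 := by
    rw [hφ0]
    exact hc.ne'
  have h1 := hφ.cos.rpow_const (p := 1 / α) (Or.inl hc')
  have h2 := (hasDerivAt_id τ).fun_mul ((h1.fun_mul hφ.sin).fun_div hφ.cos hc')
  have h3 := h2.fun_add (((hasDerivAt_powerScale (α := α) hτ).const_mul (1 - α)).mul_const χ)
  refine h3.congr_deriv ?_
  have hsc := Real.sin_sq_add_cos_sq θ
  simp only [hφ0, id, hv]
  rw [Real.rpow_sub_one hc.ne', Real.rpow_sub hc, Real.rpow_two]
  field_simp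
  linear_combination (-α * Real.cos θ * (1 - α) * χ * τ ^ α) * hsc

/-- The inverse function theorem gives a differentiable angle near `τ`. Since the Fermi distance is
unique at every nearby time, any admissible `ρ` agrees locally with `fermiDist` along this angle. -/
theorem isFermiVelocity_comoving_iff (hα0 : 0 < α) (hα1 : α < 1) (hτ : 0 < τ) (hχ : 0 < χ)
    (hθ : θ ∈ Ioo 0 (Real.pi / 2)) (hv : angleInt α θ = α * χ * τ ^ α / τ) (w : Fin 2 → ℝ) :
    IsFermiVelocity (powerScale α) τ (comoving χ) w ↔
      w = (Real.cos θ ^ (1 / α) * Real.sin θ / Real.cos θ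
        + (1 - α) / α * Real.sin θ ^ 2 * angleInt α θ) • unitRadial (powerScale α) τ := by
  have hθ' : θ ∈ Ioo (-(Real.pi / 2)) (Real.pi / 2) := ⟨by linarith [hθ.1, Real.pi_pos], hθ.2⟩
  have hs := hasStrictDerivAt_angleInt (α := α) hθ'
  have hne : Real.cos θ ^ (1 / α - 2) ≠ 0 := (Real.rpow_pos_of_pos (cos_mem_Ioo hθ).1 _).ne'
  set g := hs.localInverse _ _ _ hne with hg
  have hgd : HasDerivAt g (Real.cos θ ^ (1 / α - 2))⁻¹ (α * χ * τ ^ α / τ) :=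
    hv ▸ (hs.to_localInverse hne).hasDerivAt
  have hgθ : g (α * χ * τ ^ α / τ) = θ := by
    rw [← hv]
    exact (hs.eventually_left_inverse hne).self_of_nhds
  have hφ := HasDerivAt.comp (h := fun x => α * χ * x ^ α / x) τ hgd (hasDerivAt_angleParam (α := α) (χ := χ) hτ)
  have hρ := hasDerivAt_fermiDist_comp hα0 hτ hθ hv hgθ hφ
  have hdist : ∀ᶠ x in 𝓝 τ, ∀ d, IsFermiDistance (powerScale α) x (comoving χ) d ↔
      d = fermiDist α x χ ((g ∘ fun x => α * χ * x ^ α / x) x) := by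
    have e1 : ∀ᶠ x in 𝓝 τ, (g ∘ fun x => α * χ * x ^ α / x) x ∈ Ioo 0 (Real.pi / 2) :=
      hφ.continuousAt.eventually_mem (isOpen_Ioo.mem_nhds (by simpa [hgθ] using hθ))
    have e2 : ∀ᶠ y in 𝓝 (α * χ * τ ^ α / τ), angleInt α (g y) = y :=
      hv ▸ hs.eventually_right_inverse hne
    filter_upwards [e1, (hasDerivAt_angleParam (α := α) (χ := χ) hτ).continuousAt.eventually e2,
      eventually_gt_nhds hτ] with x hx1 hx2 hx3 d
    exact isFermiDistance_comoving_iff hα0 hα1 hx3 hχ hx1 hx2 d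
  constructor
  · rintro ⟨ρ, ρ', h1, h2, rfl⟩
    have he : ρ =ᶠ[𝓝 τ] fun x => fermiDist α x χ ((g ∘ fun x => α * χ * x ^ α / x) x) := by
      filter_upwards [h1, hdist] with x hx1 hx2
      exact (hx2 _).1 hx1
    rw [h2.unique (hρ.congr_of_eventuallyEq he)]
  · rintro rfl
    refine ⟨_, _, ?_, hρ, rfl⟩
    filter_upwards [hdist] with x hx
    exact (hx _).2 rfl

end RobertsonWalker

/-! ### The main theorem -/

theorem proposition4 (α : ℝ) (hα0 : 0 < α) (hα1 : α < 1) :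
    -- `F_α` is a bijection of `(0, 1)` onto `(0, C_α)`, so that `G_α` is well defined
    BijOn (RobertsonWalker.funF α) (Ioo 0 1) (Ioo 0 (RobertsonWalker.constC α)) ∧
    ∀ τ χ v : ℝ, 0 < τ → 0 < χ → v = α * χ / τ ^ (1 - α) →
      -- the comoving particle meets the Fermi space slice exactly when `v < v_smax`
      ((∃ t, RobertsonWalker.FermiSimultaneous (RobertsonWalker.powerScale α) τ
          (RobertsonWalker.comoving χ t)) ↔ v < α / (1 - α) * RobertsonWalker.constC α) ∧
      (v < α / (1 - α) * RobertsonWalker.constC α →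
        ∃ (ts ρ : ℝ) (vkin vFermi : Fin 2 → ℝ),
          -- the event `q_s = (ts, χ)`, the Fermi distance and both velocities exist, uniquely
          (∀ t, RobertsonWalker.FermiSimultaneous (RobertsonWalker.powerScale α) τ
            (RobertsonWalker.comoving χ t) ↔ t = ts) ∧
          (∀ d, RobertsonWalker.IsFermiDistance (RobertsonWalker.powerScale α) τ
            (RobertsonWalker.comoving χ) d ↔ d = ρ) ∧
          (∀ w, RobertsonWalker.IsKinematicVelocity (RobertsonWalker.powerScale α) τ
            (RobertsonWalker.comoving χ) w ↔ w = vkin) ∧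
          (∀ w, RobertsonWalker.IsFermiVelocity (RobertsonWalker.powerScale α) τ
            (RobertsonWalker.comoving χ) w ↔ w = vFermi) ∧
          RobertsonWalker.modulus (RobertsonWalker.powerScale α)
              (RobertsonWalker.observer τ) vkin
            = Real.sqrt (1 - ts ^ (2 * α) / τ ^ (2 * α)) ∧
          Real.sqrt (1 - ts ^ (2 * α) / τ ^ (2 * α))
            = Real.sqrt (1 - RobertsonWalker.funG α v ^ (2 * α)) ∧
          RobertsonWalker.modulus (RobertsonWalker.powerScale α)
              (RobertsonWalker.observer τ) vFermi
            = RobertsonWalker.funG α v ^ (1 - α)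
                * Real.sqrt (1 - RobertsonWalker.funG α v ^ (2 * α))
              + (1 - α) / α * (1 - RobertsonWalker.funG α v ^ (2 * α)) * v ∧
          RobertsonWalker.funG α v ^ (1 - α)
                * Real.sqrt (1 - RobertsonWalker.funG α v ^ (2 * α))
              + (1 - α) / α * (1 - RobertsonWalker.funG α v ^ (2 * α)) * v
            = ρ / τ - (1 - α) / α * RobertsonWalker.funG α v ^ (2 * α) * v) := by

  refine ⟨RobertsonWalker.bijOn_funF hα0 hα1, fun τ χ v hτ hχ hv => ?_⟩
  have hT : 0 < τ ^ α := Real.rpow_pos_of_pos hτ _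
  have hv' : v = α * χ * τ ^ α / τ := by
    rw [hv, Real.rpow_sub hτ, Real.rpow_one]
    field_simp
  have hv0 : 0 < v := by
    rw [hv']
    positivity
  refine ⟨⟨?_, fun hlt => ?_⟩, fun hlt => ?_⟩
  · rintro ⟨t, γ, γ', hg⟩
    rw [hv']
    exact hg.angle_lt hα0 hα1 hτ hχ
  · obtain ⟨θ, hθ, hθv⟩ := RobertsonWalker.exists_angleInt_eq hα0 hα1 hv0 hlt
    exact ⟨_, (RobertsonWalker.fermiSimultaneous_comoving_iff hα0 hα1 hτ hχ hθ (hθv.trans hv') _).2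
      rfl⟩
  · obtain ⟨θ, hθ, hθv⟩ := RobertsonWalker.exists_angleInt_eq hα0 hα1 hv0 hlt
    have hθv' := hθv.trans hv'
    have hc := RobertsonWalker.cos_mem_Ioo hθ
    have hs : 0 < Real.sin θ := Real.sin_pos_of_mem_Ioo ⟨hθ.1, by linarith [hθ.2, Real.pi_pos]⟩
    have hX : 0 < Real.cos θ ^ (1 / α) := Real.rpow_pos_of_pos hc.1 _
    have hG2 : (Real.cos θ ^ (1 / α)) ^ (2 * α) = Real.cos θ ^ 2 := by
      rw [← Real.rpow_mul hc.1.le, ← Real.rpow_two]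
      congr 1
      field_simp
    have hG1 : (Real.cos θ ^ (1 / α)) ^ (1 - α) = Real.cos θ ^ (1 / α) / Real.cos θ := by
      rw [Real.rpow_sub hX, Real.rpow_one, one_div, Real.rpow_inv_rpow hc.1.le hα0.ne']
    have hsqrt : √(1 - Real.cos θ ^ 2) = Real.sin θ := by
      rw [← Real.sin_sq, Real.sqrt_sq hs.le]
    have ht : (τ * Real.cos θ ^ (1 / α)) ^ (2 * α) / τ ^ (2 * α) = Real.cos θ ^ 2 := by
      rw [Real.mul_rpow hτ.le hX.le, hG2, mul_div_cancel_left₀ _ (Real.rpow_pos_of_pos hτ _).ne']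
    have ha : RobertsonWalker.powerScale α τ ≠ 0 := hT.ne'
    have h1 : 0 < 1 - α := by linarith
    refine ⟨_, _, _, _, RobertsonWalker.fermiSimultaneous_comoving_iff hα0 hα1 hτ hχ hθ hθv',
      RobertsonWalker.isFermiDistance_comoving_iff hα0 hα1 hτ hχ hθ hθv',
      RobertsonWalker.isKinematicVelocity_comoving_iff hα0 hα1 hτ hχ hθ hθv',
      RobertsonWalker.isFermiVelocity_comoving_iff hα0 hα1 hτ hχ hθ hθv', ?_⟩
    rw [← hθv, RobertsonWalker.funG_angleInt hα0 hα1 hθ, hG2, hG1, ht, hsqrt,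
      RobertsonWalker.modulus_smul_unitRadial ha, RobertsonWalker.modulus_smul_unitRadial ha,
      abs_of_pos hs, ← Real.sin_sq]
    have hI := RobertsonWalker.angleInt_pos (α := α) hθ
    refine ⟨rfl, rfl, ?_, ?_⟩
    -- Both summands of `dρ/dτ` are positive, so the absolute value in the modulus can be dropped.
    · have h2 : 0 < (1 - α) / α * Real.sin θ ^ 2 * RobertsonWalker.angleInt α θ :=
        mul_pos (mul_pos (div_pos h1 hα0) (by positivity)) hI
      rw [abs_of_pos (add_pos (div_pos (mul_pos hX hs) hc.1) h2)]
      ring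
    · rw [RobertsonWalker.fermiDist, hθv', Real.sin_sq]
      field_simp
      ring
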